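/- Let $X$ and $Y$ be complex Banach spaces, and let $A\in\mathcal B(X)$ and $B\in\mathcal B(Y)$ be bounded linear operators. The Sylvester equation $$AZ-ZB=C$$ has a unique solution $Z\in\mathcal B(Y,X)$ for every $C\in\mathcal B(Y,X)$ if and only if $\sigma(A)\cap\sigma(B)=\varnothing$. In this case the solution is $Z=Q(C)$, where $Q:\mathcal B(Y,X)\to\mathcal B(Y,X)$ is the bounded operator $$Q(C)=\frac1{(2\pi i)^2}\int_{\Gamma_1}\int_{\Gamma_2}\frac1{\lambda-\mu}\,(\lambda\mathbf 1-A)^{-1}\,C\,(\mu\mathbf 1-B)^{-1}\,d\mu\,d\lambda ,$$ i.e. the value at $w(\lambda,\mu)=\frac1{\lambda-\mu}$ of the two-variable analytic functional calculus of $A$ and $B$. Here $\Gamma_1$ and $\Gamma_2$ are any piecewise $C^1$ contours such that, for some open sets $U_1,U_2\subseteq\mathbb C$ for which $w$ is analytic on $U_1\times U_2$, the contour $\Gamma_1$ (respectively $\Gamma_2$) is the oriented boundary of a bounded open set that contains $\sigma(A)$ (respectively $\sigma(B)$) and whose closure lies in $U_1$ (respectively $U_2$); such contours exist, and $Q$ does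 not depend on their choice. -/

import Mathlib

noncomputable section

namespace SylvesterCalculus

/-! ### Contours -/

/-- A closed contour in the complex plane: finitely many `C¹` arcs, parametrized by `[0, 1]`, whose
end points are matched to initial points by a permutation, so that the arcs join up into finitely
many closed piecewise `C¹` curves. -/
structure Contour where
  /-- the number of arcs -/
  n : ℕ
  /-- the initial points of the arcs -/
  source : Fin n → ℂ
  /-- the end points of the arcs -/
  target : Fin n → ℂ
  /-- the arcs -/
  arc : ∀ i, Path (source i) (target i)
  contDiffOn_arc : ∀ i, ContDiffOn ℝ 1 (arc i).extend (Set.Icc 0 1)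
  closed : ∃ e : Equiv.Perm (Fin n), ∀ i, target i = source (e i)

namespace Contour

/-- The set of points of the plane through which the contour passes. -/
def carrier (Γ : Contour) : Set ℂ := ⋃ i, Set.range (Γ.arc i)

/-- The contour integral `∫_Γ F(z) dz` of a vector-valued function. -/
def integral {E : Type*} [NormedAddCommGroup E] [NormedSpace ℂ E] (Γ : Contour) (F : ℂ → E) : E :=
  ∑ i, curveIntegral (fun z => ContinuousLinearMap.toSpanSingleton ℂ (F z)) (Γ.arc i)

/-- The winding number `(2πi)⁻¹ ∫_Γ (ζ - z)⁻¹ dζ` of the contour about `z`. -/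
def index (Γ : Contour) (z : ℂ) : ℂ :=
  (2 * Real.pi * Complex.I)⁻¹ * Γ.integral fun ζ => (ζ - z)⁻¹

/-- `Γ` is the oriented boundary of the bounded open set `V`: as a point set it is the boundary
of `V`, it winds once counterclockwise around the points of `V`, and it does not wind around the
points outside the closure of `V`. -/
structure IsOrientedBoundary (Γ : Contour) (V : Set ℂ) : Prop where
  isOpen : IsOpen V
  isBounded : Bornology.IsBounded V
  carrier_eq : Γ.carrier = frontier V
  index_eq_one : ∀ z ∈ V, Γ.index z = 1
  index_eq_zero : ∀ z ∉ closure V, Γ.index z = 0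

/-- `Γ` is an oriented envelope of the set `σ` with respect to the point `∞` and the complement
of `U`: the oriented boundary of a bounded open set that contains `σ` and whose closure lies
in `U`. -/
def IsOrientedEnvelope (Γ : Contour) (σ U : Set ℂ) : Prop :=
  ∃ V : Set ℂ, Γ.IsOrientedBoundary V ∧ σ ⊆ V ∧ closure V ⊆ U

end Contour

/-! ### The functional calculus in two variables -/

section Calculus

variable {X Y : Type*} [NormedAddCommGroup X] [NormedSpace ℂ X]
  [NormedAddCommGroup Y] [NormedSpace ℂ Y]

/-- The transformator `S ⊠ T : C ↦ S C T` on `B(Y, X)`. -/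
def boxTensor (S : X →L[ℂ] X) (T : Y →L[ℂ] Y) : (Y →L[ℂ] X) →L[ℂ] (Y →L[ℂ] X) :=
  (ContinuousLinearMap.compL ℂ Y X X S).comp ((ContinuousLinearMap.compL ℂ Y Y X).flip T)

theorem boxTensor_apply (S : X →L[ℂ] X) (T : Y →L[ℂ] Y) (C : Y →L[ℂ] X) :
    boxTensor S T C = S.comp (C.comp T) := rfl

/-- The transformator
`(2πi)⁻² ∫_{Γ₁} ∫_{Γ₂} f(z, w) (z - A)⁻¹ ⊠ (w - B)⁻¹ dw dz` on `B(Y, X)`. -/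
def boxIntegral (A : X →L[ℂ] X) (B : Y →L[ℂ] Y) (f : ℂ → ℂ → ℂ) (Γ₁ Γ₂ : Contour) :
    (Y →L[ℂ] X) →L[ℂ] (Y →L[ℂ] X) :=
  ((2 * Real.pi * Complex.I) ^ 2)⁻¹ •
    Γ₁.integral fun z => Γ₂.integral fun w =>
      f z w • boxTensor (resolvent A z) (resolvent B w)

/-- The data that the calculus of `A` and `B` uses for `f`: open sets `U₁`, `U₂` such that `f` is
analytic on `U₁ × U₂`, and oriented envelopes `Γ₁`, `Γ₂` of the spectra of `A` and `B` in `U₁`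
and `U₂` (so that `U₁ × U₂` is a neighbourhood of the product of the spectra). -/
structure IsAdmissible (A : X →L[ℂ] X) (B : Y →L[ℂ] Y) (f : ℂ → ℂ → ℂ)
    (U₁ U₂ : Set ℂ) (Γ₁ Γ₂ : Contour) : Prop where
  isOpen_left : IsOpen U₁
  isOpen_right : IsOpen U₂
  analytic : AnalyticOnNhd ℂ (fun p : ℂ × ℂ => f p.1 p.2) (U₁ ×ˢ U₂)
  envelope_left : Γ₁.IsOrientedEnvelope (spectrum ℂ A) U₁
  envelope_right : Γ₂.IsOrientedEnvelope (spectrum ℂ B) U₂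

/-- The two-variable calculus of `A` and `B` is defined at `f`, and its value there is the
transformator `T`: admissible neighbourhoods and contours exist, and `T` is given by the double
contour integral for every admissible choice of them. -/
def IsBoxCalculus (A : X →L[ℂ] X) (B : Y →L[ℂ] Y) (f : ℂ → ℂ → ℂ)
    (T : (Y →L[ℂ] X) →L[ℂ] (Y →L[ℂ] X)) : Prop :=
  (∃ U₁ U₂ Γ₁ Γ₂, IsAdmissible A B f U₁ U₂ Γ₁ Γ₂) ∧
    ∀ U₁ U₂ Γ₁ Γ₂, IsAdmissible A B f U₁ U₂ Γ₁ Γ₂ → T = boxIntegral A B f Γ₁ Γ₂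

end Calculus

end SylvesterCalculus

end

/-! Let `T` be the operator `Z ↦ A Z - Z B`, and let `L z`, `M w` be left multiplication by the
resolvent of `A` and right multiplication by the resolvent of `B`. Since `A R = z R - 1` for the
resolvent `R` of `A` at `z`, and likewise for `B`, one gets `T (L z) (M w) = (z - w) (L z) (M w) - M
w + L z`, and the same with `T` on the right. Divide by `z - w` and integrate over both contours.
The first term gives `(2πi)²`, because a resolvent integrates to `2πi` (`integral_resolvent`). The
other two vanish: analyticity of `1 / (z - w)` forces `U₁` and `U₂` to be disjoint, so neither
contour winds around a point of the other. Hence every admissible double integral is a two-sided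
inverse of `T` (`IsAdmissible.boxIntegral_inverse`), and independence of the contours is uniqueness
of inverses. Winding numbers and Liouville's theorem take the place of a general Cauchy theorem.

Conversely, let `T` be bijective and suppose that the spectra meet. Their compact intersection has a
frontier point `μ`, which lies on the frontier of one of the two spectra. There the operator is a
limit of invertible ones, so it is neither bounded below nor surjective. Testing `T` on rank-one
operators shows that `μ - B` is onto if `μ - A` is not bounded below, and that `μ - A` is onto if `μ
- B` is not bounded below. Together these make `μ - A` or `μ - B` invertible, a contradiction.

Contours exist because a compact set can be covered by squares of a fine grid. The boundary of their
union is a contour whose index is computed square by square with logarithms. -/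

noncomputable section

namespace SylvesterCalculus

open Set Filter Topology MeasureTheory

/-! ### Integration along contours -/

namespace Contour

variable {E F : Type*} [NormedAddCommGroup E] [NormedSpace ℂ E] [NormedAddCommGroup F]
  [NormedSpace ℂ F] (Γ Γ₁ Γ₂ : Contour)

/-- The velocity of the `i`-th arc of a contour. -/
def velocity (i : Fin Γ.n) (t : ℝ) : ℂ := derivWithin (Γ.arc i).extend (Icc 0 1) t

theorem continuousOn_velocity (i : Fin Γ.n) : ContinuousOn (Γ.velocity i) (Icc 0 1) :=
  (Γ.contDiffOn_arc i).continuousOn_derivWithin uniqueDiffOn_Icc_zero_one le_rfl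

theorem extend_mem_carrier (i : Fin Γ.n) (t : ℝ) : (Γ.arc i).extend t ∈ Γ.carrier :=
  mem_iUnion.2 ⟨i, _, rfl⟩

theorem isCompact_carrier : IsCompact Γ.carrier :=
  isCompact_iUnion fun i => isCompact_range (Γ.arc i).continuous

theorem integral_eq_sum (f : ℂ → E) :
    Γ.integral f = ∑ i, ∫ t in (0 : ℝ)..1, Γ.velocity i t • f ((Γ.arc i).extend t) := by
  simp only [integral, curveIntegral_def, curveIntegralFun_def,
    ContinuousLinearMap.toSpanSingleton_apply]
  rfl

variable {Γ}

theorem continuousOn_integrand {f : ℂ → E} (hf : ContinuousOn f Γ.carrier) (i : Fin Γ.n) :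
    ContinuousOn (fun t => Γ.velocity i t • f ((Γ.arc i).extend t)) (Icc 0 1) :=
  (Γ.continuousOn_velocity i).smul
    (hf.comp (Γ.arc i).continuous_extend.continuousOn fun t _ => Γ.extend_mem_carrier i t)

theorem intervalIntegrable_integrand {f : ℂ → E} (hf : ContinuousOn f Γ.carrier) (i : Fin Γ.n) :
    IntervalIntegrable (fun t => Γ.velocity i t • f ((Γ.arc i).extend t)) volume 0 1 :=
  (continuousOn_integrand hf i).intervalIntegrable_of_Icc zero_le_one

theorem integral_congr {f g : ℂ → E} (h : EqOn f g Γ.carrier) : Γ.integral f = Γ.integral g := by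
  simp only [integral_eq_sum]
  refine Finset.sum_congr rfl fun i _ => ?_
  simp only [h (Γ.extend_mem_carrier i _)]

theorem integral_zero : (Γ.integral fun _ => (0 : E)) = 0 := by
  simp [integral_eq_sum]

theorem integral_add {f g : ℂ → E} (hf : ContinuousOn f Γ.carrier)
    (hg : ContinuousOn g Γ.carrier) :
    (Γ.integral fun z => f z + g z) = Γ.integral f + Γ.integral g := by
  simp only [integral_eq_sum, smul_add, ← Finset.sum_add_distrib]
  exact Finset.sum_congr rfl fun i _ => intervalIntegral.integral_add
    (intervalIntegrable_integrand hf i) (intervalIntegrable_integrand hg i)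

theorem integral_sub {f g : ℂ → E} (hf : ContinuousOn f Γ.carrier)
    (hg : ContinuousOn g Γ.carrier) :
    (Γ.integral fun z => f z - g z) = Γ.integral f - Γ.integral g := by
  simp only [integral_eq_sum, smul_sub, ← Finset.sum_sub_distrib]
  exact Finset.sum_congr rfl fun i _ => intervalIntegral.integral_sub
    (intervalIntegrable_integrand hf i) (intervalIntegrable_integrand hg i)

theorem integral_neg {f : ℂ → E} : (Γ.integral fun z => -f z) = -Γ.integral f := by
  simp only [integral_eq_sum, smul_neg, intervalIntegral.integral_neg, Finset.sum_neg_distrib]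

theorem integral_comp_clm [CompleteSpace E] [CompleteSpace F] (L : E →L[ℂ] F) {f : ℂ → E}
    (hf : ContinuousOn f Γ.carrier) :
    (Γ.integral fun z => L (f z)) = L (Γ.integral f) := by
  simp only [integral_eq_sum, map_sum, ← map_smul]
  exact Finset.sum_congr rfl fun i _ =>
    L.intervalIntegral_comp_comm (intervalIntegrable_integrand hf i)

theorem integral_smul_const [CompleteSpace E] {f : ℂ → ℂ} (hf : ContinuousOn f Γ.carrier)
    (x : E) : (Γ.integral fun z => f z • x) = Γ.integral f • x :=
  integral_comp_clm (ContinuousLinearMap.toSpanSingleton ℂ x) hf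

-- Fubini on each pair of arcs. It is needed because one error term in `map_integral_integral`
-- vanishes only when the first variable is integrated first.
variable {Γ₁ Γ₂} in
theorem integral_swap {f : ℂ → ℂ → E}
    (hf : ContinuousOn (fun p : ℂ × ℂ => f p.1 p.2) (Γ₁.carrier ×ˢ Γ₂.carrier)) :
    (Γ₁.integral fun z => Γ₂.integral fun w => f z w) =
      Γ₂.integral fun w => Γ₁.integral fun z => f z w := by
  have h1 : ∀ z ∈ Γ₁.carrier, ContinuousOn (f z) Γ₂.carrier := fun z hz =>
    hf.comp (f := fun w => (z, w)) (by fun_prop) fun w hw => ⟨hz, hw⟩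
  have h2 : ∀ w ∈ Γ₂.carrier, ContinuousOn (fun z => f z w) Γ₁.carrier := fun w hw =>
    hf.comp (f := fun z => (z, w)) (by fun_prop) fun z hz => ⟨hz, hw⟩
  simp only [integral_eq_sum, Finset.smul_sum, ← intervalIntegral.integral_smul]
  have key : ∀ i j, ContinuousOn (fun p : ℝ × ℝ => Γ₁.velocity i p.1 • Γ₂.velocity j p.2 •
      f ((Γ₁.arc i).extend p.1) ((Γ₂.arc j).extend p.2)) (Icc 0 1 ×ˢ Icc 0 1) := by
    intro i j
    refine ((Γ₁.continuousOn_velocity i).comp continuousOn_fst fun p hp => hp.1).smul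
      (((Γ₂.continuousOn_velocity j).comp continuousOn_snd fun p hp => hp.2).smul ?_)
    refine hf.comp (f := fun p : ℝ × ℝ => ((Γ₁.arc i).extend p.1, (Γ₂.arc j).extend p.2))
      (by fun_prop) fun p _ => ⟨Γ₁.extend_mem_carrier i _, Γ₂.extend_mem_carrier j _⟩
  have comm : ∀ i j t s, Γ₂.velocity j s • Γ₁.velocity i t •
      f ((Γ₁.arc i).extend t) ((Γ₂.arc j).extend s) = Γ₁.velocity i t • Γ₂.velocity j s •
      f ((Γ₁.arc i).extend t) ((Γ₂.arc j).extend s) := fun i j t s => smul_comm _ _ _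
  have swap : ∀ i j, (∫ t in (0 : ℝ)..1, ∫ s in (0 : ℝ)..1, Γ₁.velocity i t • Γ₂.velocity j s •
      f ((Γ₁.arc i).extend t) ((Γ₂.arc j).extend s)) = ∫ s in (0 : ℝ)..1, ∫ t in (0 : ℝ)..1,
      Γ₂.velocity j s • Γ₁.velocity i t •
      f ((Γ₁.arc i).extend t) ((Γ₂.arc j).extend s) := by
    intro i j
    simp only [comm]
    simp only [intervalIntegral.integral_of_le zero_le_one, ← integral_Icc_eq_integral_Ioc]
    refine integral_integral_swap ?_
    rw [Measure.prod_restrict, Function.uncurry_def]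
    exact (key i j).integrableOn_compact (isCompact_Icc.prod isCompact_Icc)
  have int1 : ∀ i j, IntervalIntegrable (fun t => ∫ s in (0 : ℝ)..1, Γ₁.velocity i t •
      Γ₂.velocity j s • f ((Γ₁.arc i).extend t) ((Γ₂.arc j).extend s)) volume 0 1 := by
    intro i j
    simp only [intervalIntegral.integral_of_le zero_le_one, ← integral_Icc_eq_integral_Ioc]
    rw [intervalIntegrable_iff_integrableOn_Icc_of_le zero_le_one]
    have : IntegrableOn _ _ (volume.prod volume) :=
      (key i j).integrableOn_compact (isCompact_Icc.prod isCompact_Icc)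
    rw [IntegrableOn, ← Measure.prod_restrict] at this
    exact this.integral_prod_left
  have int2 : ∀ i j, IntervalIntegrable (fun s => ∫ t in (0 : ℝ)..1, Γ₂.velocity j s •
      Γ₁.velocity i t • f ((Γ₁.arc i).extend t) ((Γ₂.arc j).extend s)) volume 0 1 := by
    intro i j
    simp only [comm]
    simp only [intervalIntegral.integral_of_le zero_le_one, ← integral_Icc_eq_integral_Ioc]
    rw [intervalIntegrable_iff_integrableOn_Icc_of_le zero_le_one]
    have : IntegrableOn _ _ (volume.prod volume) :=
      (key i j).integrableOn_compact (isCompact_Icc.prod isCompact_Icc)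
    rw [IntegrableOn, ← Measure.prod_restrict] at this
    exact this.integral_prod_right
  simp only [intervalIntegral.integral_finsetSum fun j _ => int1 _ j,
    intervalIntegral.integral_finsetSum fun i _ => int2 i _]
  rw [Finset.sum_comm]
  exact Finset.sum_congr rfl fun j _ => Finset.sum_congr rfl fun i _ => swap i j

/-- A Cauchy type integral is holomorphic off the contour. -/
theorem differentiableAt_cauchyIntegral {f : ℂ → E} (hf : ContinuousOn f Γ.carrier) {z₀ : ℂ}
    (hz₀ : z₀ ∉ Γ.carrier) :
    DifferentiableAt ℂ (fun z => Γ.integral fun ζ => (ζ - z)⁻¹ • f ζ) z₀ := by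
  simp only [integral_eq_sum]
  refine DifferentiableAt.fun_sum fun i _ => ?_
  -- A ball of radius `r` about `z₀` misses the contour, so points of the ball of half the radius
  -- stay at distance `r / 2` from it. This dominates the differentiated kernel.
  obtain ⟨r, hr, hball⟩ := Metric.isOpen_iff.1 Γ.isCompact_carrier.isClosed.isOpen_compl z₀ hz₀
  have hne : ∀ x ∈ Metric.ball z₀ (r / 2), ∀ t, r / 2 ≤ ‖(Γ.arc i).extend t - x‖ := by
    intro x hx t
    by_contra! h
    refine hball (a := (Γ.arc i).extend t) ?_ (Γ.extend_mem_carrier i t)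
    rw [Metric.mem_ball, dist_eq_norm] at hx ⊢
    calc _ = ‖((Γ.arc i).extend t - x) + (x - z₀)‖ := by congr 1; ring
      _ ≤ _ := norm_add_le _ _
      _ < r := by linarith
  have hne0 : ∀ x ∈ Metric.ball z₀ (r / 2), ∀ t, (Γ.arc i).extend t - x ≠ 0 := by
    intro x hx t h
    have := hne x hx t
    rw [h, norm_zero] at this
    linarith
  have hmem : Metric.ball z₀ (r / 2) ∈ 𝓝 z₀ := Metric.ball_mem_nhds _ (by positivity)
  -- Exponent 1 is the integrand, exponent 2 its derivative in `x`.
  have hcont : ∀ x ∈ Metric.ball z₀ (r / 2), ∀ k : ℕ, ContinuousOn (fun t => Γ.velocity i t •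
      (((Γ.arc i).extend t - x)⁻¹ ^ k) • f ((Γ.arc i).extend t)) (Icc 0 1) := by
    intro x hx k
    refine (Γ.continuousOn_velocity i).smul (ContinuousOn.smul ?_ ?_)
    · exact (Continuous.inv₀ (by fun_prop) (hne0 x hx)).continuousOn.pow k
    · exact hf.comp (Γ.arc i).continuous_extend.continuousOn fun t _ => Γ.extend_mem_carrier i t
  have hint : ∀ x ∈ Metric.ball z₀ (r / 2), ∀ k : ℕ, IntervalIntegrable (fun t => Γ.velocity i t •
      (((Γ.arc i).extend t - x)⁻¹ ^ k) • f ((Γ.arc i).extend t)) volume 0 1 := fun x hx k =>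
    (hcont x hx k).intervalIntegrable_of_Icc zero_le_one
  have hz : z₀ ∈ Metric.ball z₀ (r / 2) := Metric.mem_ball_self (by positivity)
  refine (intervalIntegral.hasDerivAt_integral_of_dominated_loc_of_deriv_le (𝕜 := ℂ)
    (F' := fun x t => Γ.velocity i t • (((Γ.arc i).extend t - x)⁻¹ ^ 2) •
      f ((Γ.arc i).extend t))
    (bound := fun t => (r / 2)⁻¹ ^ 2 * ‖Γ.velocity i t • f ((Γ.arc i).extend t)‖)
    hmem ?_ ?_ ?_ ?_ ?_ ?_).2.differentiableAt
  · filter_upwards [hmem] with x hx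
    simpa using (hint x hx 1).aestronglyMeasurable_restrict_uIoc
  · simpa using hint z₀ hz 1
  · exact (hint z₀ hz 2).aestronglyMeasurable_restrict_uIoc
  · refine Eventually.of_forall fun t _ x hx => ?_
    rw [smul_comm, norm_smul, norm_pow, norm_inv]
    gcongr
    exact hne x hx t
  · exact (continuousOn_const.mul (continuousOn_integrand hf i).norm).intervalIntegrable_of_Icc zero_le_one
  · refine Eventually.of_forall fun t _ x hx => ?_
    refine (HasDerivAt.smul_const ?_ _).const_smul _
    have := ((hasDerivAt_id' x).const_sub ((Γ.arc i).extend t)).fun_inv (hne0 x hx t)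
    simpa only [neg_neg, one_div, inv_pow] using this

theorem continuousAt_index {z₀ : ℂ} (hz₀ : z₀ ∉ Γ.carrier) : ContinuousAt Γ.index z₀ := by
  have := (differentiableAt_cauchyIntegral (Γ := Γ) (f := fun _ => (1 : ℂ)) continuousOn_const
    hz₀).continuousAt
  simp only [smul_eq_mul, mul_one] at this
  exact this.const_mul _

end Contour

/-! ### The integral of the resolvent -/

namespace Contour

variable {𝔄 : Type*} [NormedRing 𝔄] [NormedAlgebra ℂ 𝔄] {Γ : Contour}

theorem resolvent_sub_resolvent {a : 𝔄} {z w : ℂ} (hz : z ∉ spectrum ℂ a)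
    (hw : w ∉ spectrum ℂ a) :
    resolvent a z - resolvent a w = (w - z) • (resolvent a z * resolvent a w) := by
  have h1 : resolvent a z * (algebraMap ℂ 𝔄 z - a) = 1 :=
    Ring.inverse_mul_cancel _ (spectrum.notMem_iff.1 hz)
  have h2 : (algebraMap ℂ 𝔄 w - a) * resolvent a w = 1 :=
    Ring.mul_inverse_cancel _ (spectrum.notMem_iff.1 hw)
  calc resolvent a z - resolvent a w
      = resolvent a z * ((algebraMap ℂ 𝔄 w - a) * resolvent a w) -
        (resolvent a z * (algebraMap ℂ 𝔄 z - a)) * resolvent a w := by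
        rw [h1, h2, mul_one, one_mul]
    _ = resolvent a z * (algebraMap ℂ 𝔄 (w - z)) * resolvent a w := by
        rw [map_sub]; noncomm_ring
    _ = _ := by rw [← Algebra.commutes, mul_assoc, Algebra.smul_def]

variable [CompleteSpace 𝔄]

theorem continuousOn_resolvent (a : 𝔄) : ContinuousOn (resolvent a) (spectrum ℂ a)ᶜ :=
  fun _ hz => (spectrum.hasDerivAt_resolvent_const_left
    (notMem_compl_iff.1 fun h => hz h)).continuousAt.continuousWithinAt

/-- The integral of the resolvent along a contour that winds once around the spectrum. -/
theorem integral_resolvent {a : 𝔄} {V : Set ℂ} (hV : IsOpen V) (hσ : spectrum ℂ a ⊆ V)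
    (hΓ : Disjoint Γ.carrier V) (hind : ∀ z ∈ V, Γ.index z = 1) :
    Γ.integral (resolvent a) = (2 * Real.pi * Complex.I : ℂ) • (1 : 𝔄) := by
  classical
  set c : ℂ := 2 * Real.pi * Complex.I with hc
  have hc0 : c ≠ 0 := Complex.two_pi_I_ne_zero
  have hΓσ : Γ.carrier ⊆ (spectrum ℂ a)ᶜ := fun z hz hz' => hΓ.le_bot ⟨hz, hσ hz'⟩
  have hR := (continuousOn_resolvent a).mono hΓσ
  set P : 𝔄 := c⁻¹ • Γ.integral (resolvent a) with hP
  set G : ℂ → 𝔄 := fun z => c⁻¹ • Γ.integral fun ζ => (ζ - z)⁻¹ • resolvent a ζ with hG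
  -- The resolvent identity gives `R(ζ) R(z) = (ζ - z)⁻¹ (R(z) - R(ζ))`. Integrating over `ζ` with
  -- winding number one yields `P R(z) = R(z) - G(z)`.
  have agree : ∀ z ∈ V, z ∉ spectrum ℂ a → (1 - P) * resolvent a z = G z := by
    intro z hzV hz
    have hne : ∀ ζ ∈ Γ.carrier, ζ - z ≠ 0 := fun ζ hζ h =>
      hΓ.le_bot ⟨hζ, by rwa [sub_eq_zero.1 h]⟩
    have hinv : ContinuousOn (fun ζ : ℂ => (ζ - z)⁻¹) Γ.carrier :=
      ContinuousOn.inv₀ (by fun_prop) hne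
    have h1 : Γ.integral (fun ζ => (ζ - z)⁻¹ • resolvent a ζ) =
        (c * Γ.index z) • resolvent a z - Γ.integral (resolvent a) * resolvent a z := by
      have hi : c * Γ.index z = Γ.integral fun ζ => (ζ - z)⁻¹ := by
        rw [index, mul_inv_cancel_left₀ hc0]
      have hm := integral_comp_clm ((ContinuousLinearMap.mul ℂ 𝔄).flip (resolvent a z)) hR
      simp only [ContinuousLinearMap.flip_apply, ContinuousLinearMap.mul_apply'] at hm
      rw [hi, ← integral_smul_const hinv, ← hm]
      refine (integral_congr fun ζ hζ => ?_).trans (integral_sub (hinv.smul continuousOn_const)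
        (hR.mul continuousOn_const))
      have e : resolvent a ζ * resolvent a z = (ζ - z)⁻¹ • (resolvent a z - resolvent a ζ) := by
        rw [← neg_sub (resolvent a ζ), resolvent_sub_resolvent (hΓσ hζ) hz, ← neg_smul, neg_sub,
          smul_smul, inv_mul_cancel₀ (hne ζ hζ), one_smul]
      change _ = (ζ - z)⁻¹ • resolvent a z - resolvent a ζ * resolvent a z
      rw [e, smul_sub, sub_sub_cancel]
    rw [hG]
    simp only [h1, hind z hzV, mul_one, smul_sub, smul_smul, inv_mul_cancel₀ hc0, one_smul,
      sub_mul, one_mul, hP, smul_mul_assoc]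
  -- `G` is holomorphic across the spectrum and `(1 - P) R` off it; they agree on the overlap, so
  -- they glue to an entire function.
  set H : ℂ → 𝔄 := fun z => if z ∈ V then G z else (1 - P) * resolvent a z with hH
  have hH1 : ∀ z ∉ spectrum ℂ a, H z = (1 - P) * resolvent a z := by
    intro z hz
    by_cases h : z ∈ V
    · simp only [hH, h, if_true, agree z h hz]
    · simp only [hH, h, if_false]
  have hdiff : Differentiable ℂ H := by
    intro z
    by_cases h : z ∈ spectrum ℂ a
    · have : H =ᶠ[𝓝 z] G := by
        filter_upwards [hV.mem_nhds (hσ h)] with w hw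
        simp only [hH, hw, if_true]
      exact ((differentiableAt_cauchyIntegral hR
        fun hz => hΓσ hz h).const_smul c⁻¹).congr_of_eventuallyEq this
    · have : H =ᶠ[𝓝 z] fun w => (1 - P) * resolvent a w := by
        filter_upwards [(spectrum.isClosed a).isOpen_compl.mem_nhds h] with w hw
        exact hH1 w hw
      exact ((spectrum.hasDerivAt_resolvent_const_left (notMem_compl_iff.1
        fun h' => h h')).differentiableAt.const_mul _).congr_of_eventuallyEq this
  -- The resolvent vanishes at infinity, so Liouville's theorem gives `H = 0`.
  have hlim : Tendsto H (cocompact ℂ) (𝓝 0) := by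
    have h0 : Tendsto (fun z => (1 - P) * resolvent a z) (cocompact ℂ) (𝓝 0) := by
      have := (spectrum.resolvent_tendsto_cobounded (𝕜 := ℂ) a).const_mul (1 - P)
      rwa [mul_zero, Metric.cobounded_eq_cocompact] at this
    refine h0.congr' ?_
    filter_upwards [(spectrum.isCompact a).compl_mem_cocompact] with z hz
    exact (hH1 z hz).symm
  have hzero : ∀ z, H z = 0 := fun z => hdiff.apply_eq_of_tendsto_cocompact z hlim
  -- At any point off the compact spectrum the resolvent is invertible and cancels from `(1 - P)
  -- R(z) = 0`.
  obtain ⟨z, hz⟩ : ((spectrum ℂ a)ᶜ).Nonempty := by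
    rw [nonempty_compl]
    intro h
    exact noncompact_univ ℂ (h ▸ spectrum.isCompact a)
  have h1 : (1 - P) * resolvent a z = 0 := by rw [← hH1 z hz, hzero]
  have h2 : (1 - P) = 0 := by
    have := congrArg (· * (algebraMap ℂ 𝔄 z - a)) h1
    simpa only [mul_assoc, resolvent, Ring.inverse_mul_cancel _ (spectrum.notMem_iff.1 hz), mul_one,
      zero_mul] using this
  rw [sub_eq_zero.1 h2, hP, smul_smul, mul_inv_cancel₀ hc0, one_smul]

end Contour

/-! ### Double integrals with kernel `1 / (z - w)` -/

namespace Contour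

variable {E : Type*} [NormedAddCommGroup E] [NormedSpace ℂ E]
variable {𝔄 : Type*} [NormedRing 𝔄] [NormedAlgebra ℂ 𝔄] [CompleteSpace 𝔄]
variable {Γ₁ Γ₂ : Contour}

theorem continuousOn_integral {f : ℂ → ℂ → E}
    (hf : ContinuousOn (fun p : ℂ × ℂ => f p.1 p.2) (Γ₁.carrier ×ˢ Γ₂.carrier)) :
    ContinuousOn (fun z => Γ₂.integral fun w => f z w) Γ₁.carrier := by
  obtain ⟨C, hC⟩ := (Γ₁.isCompact_carrier.prod Γ₂.isCompact_carrier).exists_bound_of_continuousOn hf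
  have h1 : ∀ z ∈ Γ₁.carrier, ContinuousOn (f z) Γ₂.carrier := fun z hz =>
    hf.comp (f := fun w => (z, w)) (by fun_prop) fun w hw => ⟨hz, hw⟩
  have h2 : ∀ w ∈ Γ₂.carrier, ContinuousOn (fun z => f z w) Γ₁.carrier := fun w hw =>
    hf.comp (f := fun z => (z, w)) (by fun_prop) fun z hz => ⟨hz, hw⟩
  simp only [integral_eq_sum]
  refine continuousOn_finsetSum _ fun i _ z hz => ?_
  refine intervalIntegral.continuousWithinAt_of_dominated_interval
    (bound := fun t => ‖Γ₂.velocity i t‖ * C) ?_ ?_ ?_ ?_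
  · filter_upwards [self_mem_nhdsWithin] with x hx
    exact (intervalIntegrable_integrand (h1 x hx) i).aestronglyMeasurable_restrict_uIoc
  · filter_upwards [self_mem_nhdsWithin] with x hx
    refine Eventually.of_forall fun t _ => ?_
    rw [norm_smul]
    gcongr
    exact hC (x, (Γ₂.arc i).extend t) ⟨hx, Γ₂.extend_mem_carrier i t⟩
  · exact ((Γ₂.continuousOn_velocity i).norm.mul continuousOn_const).intervalIntegrable_of_Icc
      zero_le_one
  · exact Eventually.of_forall fun t _ => (h2 _ (Γ₂.extend_mem_carrier i t) z hz).const_smul _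

/-- The kernel `1 / (z - w)` inverts an operator `K` that acts on the products of two resolvents
as a difference of commuting elements does. -/
theorem map_integral_integral {L M : ℂ → 𝔄}
    (hL : ContinuousOn L Γ₁.carrier) (hM : ContinuousOn M Γ₂.carrier)
    (hLi : Γ₁.integral L = (2 * Real.pi * Complex.I : ℂ) • (1 : 𝔄))
    (hMi : Γ₂.integral M = (2 * Real.pi * Complex.I : ℂ) • (1 : 𝔄))
    (hd : Disjoint Γ₁.carrier Γ₂.carrier)
    (h₁ : ∀ w ∈ Γ₂.carrier, Γ₁.index w = 0) (h₂ : ∀ z ∈ Γ₁.carrier, Γ₂.index z = 0)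
    (K : 𝔄 →L[ℂ] 𝔄)
    (hK : ∀ z ∈ Γ₁.carrier, ∀ w ∈ Γ₂.carrier,
      K (L z * M w) = (z - w) • (L z * M w) - M w + L z) :
    K (Γ₁.integral fun z => Γ₂.integral fun w => (1 / (z - w)) • (L z * M w)) =
      ((2 * Real.pi * Complex.I) ^ 2 : ℂ) • (1 : 𝔄) := by
  have index_zero : ∀ (Γ : Contour) (z : ℂ), Γ.index z = 0 →
      Γ.integral (fun ζ => (ζ - z)⁻¹) = 0 := fun Γ z h =>
    (mul_eq_zero.1 h).resolve_left (inv_ne_zero Complex.two_pi_I_ne_zero)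
  set c : ℂ := 2 * Real.pi * Complex.I with hc
  have hne : ∀ z ∈ Γ₁.carrier, ∀ w ∈ Γ₂.carrier, z - w ≠ 0 := fun z hz w hw h =>
    hd.le_bot ⟨hz, by rwa [sub_eq_zero.1 h]⟩
  have hinv : ContinuousOn (fun p : ℂ × ℂ => (p.1 - p.2)⁻¹) (Γ₁.carrier ×ˢ Γ₂.carrier) :=
    ContinuousOn.inv₀ (by fun_prop) fun p hp => hne _ hp.1 _ hp.2
  have hL' : ContinuousOn (fun p : ℂ × ℂ => L p.1) (Γ₁.carrier ×ˢ Γ₂.carrier) :=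
    hL.comp continuousOn_fst fun p hp => hp.1
  have hM' : ContinuousOn (fun p : ℂ × ℂ => M p.2) (Γ₁.carrier ×ˢ Γ₂.carrier) :=
    hM.comp continuousOn_snd fun p hp => hp.2
  have slice : ∀ {f : ℂ → ℂ → 𝔄},
      ContinuousOn (fun p : ℂ × ℂ => f p.1 p.2) (Γ₁.carrier ×ˢ Γ₂.carrier) →
      ∀ z ∈ Γ₁.carrier, ContinuousOn (f z) Γ₂.carrier := fun hf z hz =>
    hf.comp (f := fun w => (z, w)) (by fun_prop) fun w hw => ⟨hz, hw⟩
  have c0 : ContinuousOn (fun p : ℂ × ℂ => (1 / (p.1 - p.2)) • (L p.1 * M p.2))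
      (Γ₁.carrier ×ˢ Γ₂.carrier) := by
    simp only [one_div]
    exact hinv.smul (hL'.mul hM')
  have c1 : ContinuousOn (fun p : ℂ × ℂ => L p.1 * M p.2) (Γ₁.carrier ×ˢ Γ₂.carrier) :=
    hL'.mul hM'
  have c2 : ContinuousOn (fun p : ℂ × ℂ => (p.1 - p.2)⁻¹ • M p.2) (Γ₁.carrier ×ˢ Γ₂.carrier) :=
    hinv.smul hM'
  have c3 : ContinuousOn (fun p : ℂ × ℂ => (p.1 - p.2)⁻¹ • L p.1) (Γ₁.carrier ×ˢ Γ₂.carrier) :=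
    hinv.smul hL'
  have i1 : (Γ₁.integral fun z => Γ₂.integral fun w => L z * M w) = c ^ 2 • (1 : 𝔄) := by
    have : ∀ z, (Γ₂.integral fun w => L z * M w) = c • L z := fun z => by
      have := integral_comp_clm (ContinuousLinearMap.mul ℂ 𝔄 (L z)) hM
      simpa only [ContinuousLinearMap.mul_apply', hMi, mul_smul_comm, mul_one] using this
    simp only [this]
    have := integral_comp_clm (c • ContinuousLinearMap.id ℂ 𝔄) hL
    simp only [smul_apply, ContinuousLinearMap.id_apply, hLi] at this
    rw [this, smul_smul, sq]
  have i2 : (Γ₁.integral fun z => Γ₂.integral fun w => (z - w)⁻¹ • M w) = 0 := by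
    -- `M w` is constant in `z`, so the inner integral over `Γ₁` is a multiple of the index of `Γ₁`
    -- about `w`, which is zero.
    rw [integral_swap c2, ← integral_zero (Γ := Γ₂)]
    refine integral_congr fun w hw => ?_
    rw [integral_smul_const, index_zero _ _ (h₁ w hw), zero_smul]
    exact ContinuousOn.inv₀ (by fun_prop) fun z hz => hne _ hz _ hw
  have i3 : (Γ₁.integral fun z => Γ₂.integral fun w => (z - w)⁻¹ • L z) = 0 := by
    rw [← integral_zero (Γ := Γ₁)]
    refine integral_congr fun z hz => ?_
    rw [integral_smul_const]
    · have : (fun w => (z - w)⁻¹) = fun w => -(w - z)⁻¹ := by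
        funext w
        rw [← neg_sub w z, inv_neg]
      rw [this, integral_neg, index_zero _ _ (h₂ z hz), neg_zero, zero_smul]
    · exact ContinuousOn.inv₀ (by fun_prop) fun w hw => hne _ hz _ hw
  rw [← integral_comp_clm K (continuousOn_integral c0)]
  calc _ = Γ₁.integral fun z => (Γ₂.integral fun w => L z * M w) -
          (Γ₂.integral fun w => (z - w)⁻¹ • M w) + Γ₂.integral fun w => (z - w)⁻¹ • L z := by
        refine integral_congr fun z hz => ?_
        have s0 := slice (f := fun z w => (1 / (z - w)) • (L z * M w)) c0 z hz
        have s1 := slice (f := fun z w => L z * M w) c1 z hz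
        have s2 := slice (f := fun z w => (z - w)⁻¹ • M w) c2 z hz
        have s3 := slice (f := fun z w => (z - w)⁻¹ • L z) c3 z hz
        rw [← integral_comp_clm K s0]
        refine Eq.trans ?_ ((integral_add (s1.sub s2) s3).trans
          (congrArg (· + _) (integral_sub s1 s2)))
        refine integral_congr fun w hw => ?_
        simp only [one_div, map_smul, hK z hz w hw, smul_add, smul_sub, smul_smul,
          inv_mul_cancel₀ (hne z hz w hw), one_smul, Pi.sub_apply]
    _ = c ^ 2 • (1 : 𝔄) := by
        refine (integral_add ((continuousOn_integral c1).sub (continuousOn_integral c2))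
          (continuousOn_integral c3)).trans ?_
        rw [i3, add_zero]
        refine (integral_sub (continuousOn_integral c1) (continuousOn_integral c2)).trans ?_
        rw [i1, i2, sub_zero]

/-- `map_integral_integral` with `K` taken as left, respectively right, multiplication by `t`. -/
theorem inverse_integral_integral {t : 𝔄} {L M : ℂ → 𝔄}
    (hL : ContinuousOn L Γ₁.carrier) (hM : ContinuousOn M Γ₂.carrier)
    (hLi : Γ₁.integral L = (2 * Real.pi * Complex.I : ℂ) • (1 : 𝔄))
    (hMi : Γ₂.integral M = (2 * Real.pi * Complex.I : ℂ) • (1 : 𝔄))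
    (hd : Disjoint Γ₁.carrier Γ₂.carrier)
    (h₁ : ∀ w ∈ Γ₂.carrier, Γ₁.index w = 0) (h₂ : ∀ z ∈ Γ₁.carrier, Γ₂.index z = 0)
    (hl : ∀ z ∈ Γ₁.carrier, ∀ w ∈ Γ₂.carrier,
      t * (L z * M w) = (z - w) • (L z * M w) - M w + L z)
    (hr : ∀ z ∈ Γ₁.carrier, ∀ w ∈ Γ₂.carrier,
      L z * M w * t = (z - w) • (L z * M w) - M w + L z) :
    t * (((2 * Real.pi * Complex.I) ^ 2 : ℂ)⁻¹ •
      Γ₁.integral fun z => Γ₂.integral fun w => (1 / (z - w)) • (L z * M w)) = 1 ∧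
    (((2 * Real.pi * Complex.I) ^ 2 : ℂ)⁻¹ •
      Γ₁.integral fun z => Γ₂.integral fun w => (1 / (z - w)) • (L z * M w)) * t = 1 := by
  have key := map_integral_integral hL hM hLi hMi hd h₁ h₂
  have hc : ((2 * Real.pi * Complex.I) ^ 2 : ℂ) ≠ 0 := pow_ne_zero _ Complex.two_pi_I_ne_zero
  constructor
  · have := key (ContinuousLinearMap.mul ℂ 𝔄 t) hl
    rw [ContinuousLinearMap.mul_apply'] at this
    rw [mul_smul_comm, this, smul_smul, inv_mul_cancel₀ hc, one_smul]
  · have := key ((ContinuousLinearMap.mul ℂ 𝔄).flip t) hr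
    rw [ContinuousLinearMap.flip_apply, ContinuousLinearMap.mul_apply'] at this
    rw [smul_mul_assoc, this, smul_smul, inv_mul_cancel₀ hc, one_smul]

end Contour

/-! ### The Sylvester operator and its inverse -/

section Sylvester

variable {X Y : Type*} [NormedAddCommGroup X] [NormedSpace ℂ X]
  [NormedAddCommGroup Y] [NormedSpace ℂ Y]

/-- The Sylvester operator `Z ↦ A Z - Z B`. -/
def sylvester (A : X →L[ℂ] X) (B : Y →L[ℂ] Y) : (Y →L[ℂ] X) →L[ℂ] (Y →L[ℂ] X) :=
  boxTensor A 1 - boxTensor 1 B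

theorem sylvester_apply (A : X →L[ℂ] X) (B : Y →L[ℂ] Y) (Z : Y →L[ℂ] X) :
    sylvester A B Z = A.comp Z - Z.comp B := rfl

theorem boxTensor_eq_mul (S : X →L[ℂ] X) (T : Y →L[ℂ] Y) :
    boxTensor S T = boxTensor S 1 * boxTensor 1 T := rfl

theorem boxIntegral_eq (A : X →L[ℂ] X) (B : Y →L[ℂ] Y) (f : ℂ → ℂ → ℂ) (Γ₁ Γ₂ : Contour) :
    boxIntegral A B f Γ₁ Γ₂ = ((2 * Real.pi * Complex.I) ^ 2 : ℂ)⁻¹ •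
      Γ₁.integral fun z => Γ₂.integral fun w =>
        f z w • (boxTensor (resolvent A z) 1 * boxTensor 1 (resolvent B w)) := by
  simp only [boxIntegral, ← boxTensor_eq_mul]

theorem boxTensor_one_one :
    boxTensor (1 : X →L[ℂ] X) (1 : Y →L[ℂ] Y) = 1 := by
  ext C y
  rfl

theorem isBoundedLinearMap_boxTensor_left :
    IsBoundedLinearMap ℂ fun S : X →L[ℂ] X => boxTensor S (1 : Y →L[ℂ] Y) := by
  refine IsLinearMap.with_bound ⟨fun S T => rfl, fun c S => rfl⟩ 1 fun S => ?_
  refine ContinuousLinearMap.opNorm_le_bound _ (by positivity) fun C => ?_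
  rw [one_mul]
  exact ContinuousLinearMap.opNorm_comp_le S C

theorem isBoundedLinearMap_boxTensor_right :
    IsBoundedLinearMap ℂ fun T : Y →L[ℂ] Y => boxTensor (1 : X →L[ℂ] X) T := by
  refine IsLinearMap.with_bound ⟨fun S T => ?_, fun c S => ?_⟩ 1 fun S => ?_
  · ext C y
    exact map_add C _ _
  · ext C y
    exact map_smul C _ _
  · refine ContinuousLinearMap.opNorm_le_bound _ (by positivity) fun C => ?_
    rw [one_mul, mul_comm]
    exact ContinuousLinearMap.opNorm_comp_le C S

theorem sylvester_mul_boxTensor {A R : X →L[ℂ] X} {B S : Y →L[ℂ] Y} {z w : ℂ}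
    (hA : A * R = z • R - 1) (hB : S * B = w • S - 1) :
    sylvester A B * (boxTensor R 1 * boxTensor 1 S) =
      (z - w) • (boxTensor R 1 * boxTensor 1 S) - boxTensor 1 S + boxTensor R 1 := by
  ext C y
  have h1 : A (R (C (S y))) = z • R (C (S y)) - C (S y) := DFunLike.congr_fun hA (C (S y))
  have h2 : S (B y) = w • S y - y := DFunLike.congr_fun hB y
  change A (R (C (S y))) - R (C (S (B y))) = (z - w) • R (C (S y)) - C (S y) + R (C y)
  rw [h1, h2, map_sub, map_sub, map_smul, map_smul, sub_smul]
  abel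

theorem boxTensor_mul_sylvester {A R : X →L[ℂ] X} {B S : Y →L[ℂ] Y} {z w : ℂ}
    (hA : R * A = z • R - 1) (hB : B * S = w • S - 1) :
    boxTensor R 1 * boxTensor 1 S * sylvester A B =
      (z - w) • (boxTensor R 1 * boxTensor 1 S) - boxTensor 1 S + boxTensor R 1 := by
  ext C y
  have h1 : R (A (C (S y))) = z • R (C (S y)) - C (S y) := DFunLike.congr_fun hA (C (S y))
  have h2 : B (S y) = w • S y - y := DFunLike.congr_fun hB y
  change R (A (C (S y)) - C (B (S y))) = (z - w) • R (C (S y)) - C (S y) + R (C y)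
  rw [map_sub, h1, h2, map_sub, map_sub, map_smul, map_smul, sub_smul]
  abel

theorem resolvent_mul_self {R : Type*} [Ring R] [Algebra ℂ R] {a : R} {z : ℂ}
    (hz : z ∉ spectrum ℂ a) : resolvent a z * a = z • resolvent a z - 1 := by
  have h := Ring.inverse_mul_cancel _ (spectrum.notMem_iff.1 hz)
  rw [← resolvent, mul_sub, ← Algebra.commutes, ← Algebra.smul_def] at h
  rw [← h, sub_sub_cancel]

theorem self_mul_resolvent {R : Type*} [Ring R] [Algebra ℂ R] {a : R} {z : ℂ}
    (hz : z ∉ spectrum ℂ a) : a * resolvent a z = z • resolvent a z - 1 := by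
  have h := Ring.mul_inverse_cancel _ (spectrum.notMem_iff.1 hz)
  rw [← resolvent, sub_mul, ← Algebra.smul_def] at h
  rw [← h, sub_sub_cancel]

/-- With the convention `1 / 0 = 0` the kernel is defined on the diagonal but is not continuous
there: `(w - z) * (1 / (w - z))` is 1 for `w ≠ z`, while continuity would make it tend to 0. -/
theorem disjoint_of_analyticOnNhd {U₁ U₂ : Set ℂ}
    (h : AnalyticOnNhd ℂ (fun p : ℂ × ℂ => 1 / (p.1 - p.2)) (U₁ ×ˢ U₂)) : Disjoint U₁ U₂ := by
  rw [Set.disjoint_left]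
  intro z h1 h2
  have hc := (h (z, z) ⟨h1, h2⟩).continuousAt
  have hc2 : ContinuousAt (fun w : ℂ => 1 / (w - z)) z :=
    ContinuousAt.comp (f := fun w : ℂ => (w, z)) hc (by fun_prop)
  have hc3 : Tendsto (fun w : ℂ => (w - z) * (1 / (w - z))) (𝓝[≠] z) (𝓝 0) := by
    have : Tendsto (fun w : ℂ => (w - z) * (1 / (w - z))) (𝓝 z) (𝓝 ((z - z) * (1 / (z - z)))) :=
      ((continuousAt_id.sub continuousAt_const).mul hc2)
    rw [sub_self, zero_mul] at this
    exact this.mono_left nhdsWithin_le_nhds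
  have h1 : Tendsto (fun w : ℂ => (w - z) * (1 / (w - z))) (𝓝[≠] z) (𝓝 1) := by
    refine tendsto_const_nhds.congr' ?_
    filter_upwards [self_mem_nhdsWithin] with w hw
    rw [mul_one_div_cancel (sub_ne_zero.2 hw)]
  exact zero_ne_one (tendsto_nhds_unique hc3 h1)

namespace Contour

theorem integral_comp_isBoundedLinearMap {E F : Type*} [NormedAddCommGroup E] [NormedSpace ℂ E]
    [CompleteSpace E] [NormedAddCommGroup F] [NormedSpace ℂ F] [CompleteSpace F] {Γ : Contour}
    {φ : E → F} (hφ : IsBoundedLinearMap ℂ φ) {f : ℂ → E} (hf : ContinuousOn f Γ.carrier) :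
    (Γ.integral fun z => φ (f z)) = φ (Γ.integral f) :=
  integral_comp_clm hφ.toContinuousLinearMap hf

theorem IsOrientedBoundary.carrier_subset {Γ : Contour} {V : Set ℂ} (h : Γ.IsOrientedBoundary V) :
    Γ.carrier ⊆ closure V := h.carrier_eq ▸ frontier_subset_closure

theorem IsOrientedBoundary.disjoint {Γ : Contour} {V : Set ℂ} (h : Γ.IsOrientedBoundary V) :
    Disjoint Γ.carrier V := by
  rw [h.carrier_eq, h.isOpen.frontier_eq]
  exact disjoint_sdiff_left

end Contour

variable [CompleteSpace X] [CompleteSpace Y]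

/-- The double contour integral inverts the Sylvester operator. -/
theorem IsAdmissible.boxIntegral_inverse {A : X →L[ℂ] X} {B : Y →L[ℂ] Y} {U₁ U₂ : Set ℂ}
    {Γ₁ Γ₂ : Contour} (h : IsAdmissible A B (fun z w => 1 / (z - w)) U₁ U₂ Γ₁ Γ₂) :
    sylvester A B * boxIntegral A B (fun z w => 1 / (z - w)) Γ₁ Γ₂ = 1 ∧
      boxIntegral A B (fun z w => 1 / (z - w)) Γ₁ Γ₂ * sylvester A B = 1 := by
  have hU := disjoint_of_analyticOnNhd h.analytic
  obtain ⟨V₁, hV₁, hA, hVU₁⟩ := h.envelope_left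
  obtain ⟨V₂, hV₂, hB, hVU₂⟩ := h.envelope_right
  have hσ₁ : ∀ z ∈ Γ₁.carrier, z ∉ spectrum ℂ A := fun z hz hz' =>
    hV₁.disjoint.le_bot ⟨hz, hA hz'⟩
  have hσ₂ : ∀ z ∈ Γ₂.carrier, z ∉ spectrum ℂ B := fun z hz hz' =>
    hV₂.disjoint.le_bot ⟨hz, hB hz'⟩
  have hRA := (Contour.continuousOn_resolvent A).mono hσ₁
  have hRB := (Contour.continuousOn_resolvent B).mono hσ₂
  have hIA := Contour.integral_resolvent hV₁.isOpen hA hV₁.disjoint hV₁.index_eq_one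
  have hIB := Contour.integral_resolvent hV₂.isOpen hB hV₂.disjoint hV₂.index_eq_one
  have hφ := isBoundedLinearMap_boxTensor_left (X := X) (Y := Y)
  have hψ := isBoundedLinearMap_boxTensor_right (X := X) (Y := Y)
  have hL : ContinuousOn (fun z => boxTensor (resolvent A z) (1 : Y →L[ℂ] Y)) Γ₁.carrier :=
    hφ.continuous.comp_continuousOn hRA
  have hM : ContinuousOn (fun z => boxTensor (1 : X →L[ℂ] X) (resolvent B z)) Γ₂.carrier :=
    hψ.continuous.comp_continuousOn hRB
  have hLi : Γ₁.integral (fun z => boxTensor (resolvent A z) (1 : Y →L[ℂ] Y)) =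
      (2 * Real.pi * Complex.I : ℂ) • 1 := by
    have := Contour.integral_comp_isBoundedLinearMap (E := X →L[ℂ] X)
      (F := (Y →L[ℂ] X) →L[ℂ] (Y →L[ℂ] X)) hφ hRA
    rw [this, hIA, hφ.map_smul, boxTensor_one_one]
  have hMi : Γ₂.integral (fun z => boxTensor (1 : X →L[ℂ] X) (resolvent B z)) =
      (2 * Real.pi * Complex.I : ℂ) • 1 := by
    have := Contour.integral_comp_isBoundedLinearMap (E := Y →L[ℂ] Y)
      (F := (Y →L[ℂ] X) →L[ℂ] (Y →L[ℂ] X)) hψ hRB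
    rw [this, hIB, hψ.map_smul, boxTensor_one_one]
  have hd : Disjoint Γ₁.carrier Γ₂.carrier :=
    hU.mono (hV₁.carrier_subset.trans hVU₁) (hV₂.carrier_subset.trans hVU₂)
  -- `Γ₂` lies in `U₂`, which is disjoint from `U₁` and hence from the closure of the set bounded by
  -- `Γ₁`.
  have h₁ : ∀ w ∈ Γ₂.carrier, Γ₁.index w = 0 := fun w hw => hV₁.index_eq_zero w fun hw' =>
    hU.le_bot ⟨hVU₁ hw', hVU₂ (hV₂.carrier_subset hw)⟩
  have h₂ : ∀ w ∈ Γ₁.carrier, Γ₂.index w = 0 := fun w hw => hV₂.index_eq_zero w fun hw' =>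
    hU.le_bot ⟨hVU₁ (hV₁.carrier_subset hw), hVU₂ hw'⟩
  rw [boxIntegral_eq]
  exact Contour.inverse_integral_integral (𝔄 := (Y →L[ℂ] X) →L[ℂ] (Y →L[ℂ] X))
    (L := fun z => boxTensor (resolvent A z) (1 : Y →L[ℂ] Y))
    (M := fun z => boxTensor (1 : X →L[ℂ] X) (resolvent B z)) hL hM hLi hMi hd h₁ h₂
    (fun z hz w hw =>
      sylvester_mul_boxTensor (self_mul_resolvent (hσ₁ z hz)) (resolvent_mul_self (hσ₂ w hw)))
    (fun z hz w hw =>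
      boxTensor_mul_sylvester (resolvent_mul_self (hσ₁ z hz)) (self_mul_resolvent (hσ₂ w hw)))

end Sylvester

/-! ### Operators bounded below and criteria for surjectivity -/

section BoundedBelow

variable {E F : Type*} [NormedAddCommGroup E] [NormedSpace ℂ E]
  [NormedAddCommGroup F] [NormedSpace ℂ F]

/-- An operator is bounded below if it expands norms by at least a fixed positive factor. -/
def IsBoundedBelow (f : E →L[ℂ] F) : Prop := ∃ c > 0, ∀ x, c * ‖x‖ ≤ ‖f x‖

theorem IsBoundedBelow.injective {f : E →L[ℂ] F} (h : IsBoundedBelow f) :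
    Function.Injective f := by
  obtain ⟨c, hc, h⟩ := h
  refine (injective_iff_map_eq_zero f).2 fun x hx => ?_
  have := h x
  rw [hx, norm_zero] at this
  exact norm_le_zero_iff.1 (nonpos_of_mul_nonpos_right this hc)

theorem exists_norm_lt_of_not_isBoundedBelow {f : E →L[ℂ] F} (h : ¬IsBoundedBelow f) {ε : ℝ}
    (hε : 0 < ε) : ∃ x, ‖f x‖ < ε * ‖x‖ := by
  by_contra! h'
  exact h ⟨ε, hε, h'⟩

/-- An operator whose range contains approximate solutions with norm control is surjective. -/
theorem surjective_of_approx [CompleteSpace E] {f : E →L[ℂ] F} {K : ℝ}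
    (h : ∀ y, ∃ x, ‖y - f x‖ ≤ 2⁻¹ * ‖y‖ ∧ ‖x‖ ≤ K * ‖y‖) : Function.Surjective f := by
  choose g hg1 hg2 using h
  intro y
  -- The residuals at least halve in norm at each step, so the corrections `g (r n)` form an
  -- absolutely convergent series.
  let r : ℕ → F := fun n => (fun z => z - f (g z))^[n] y
  have r_succ : ∀ n, r (n + 1) = r n - f (g (r n)) := fun n =>
    Function.iterate_succ_apply' _ _ _
  have hr : ∀ n, ‖r n‖ ≤ 2⁻¹ ^ n * ‖y‖ := by
    intro n
    induction n with
    | zero => simp [r]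
    | succ n ih =>
      rw [r_succ, pow_succ', mul_assoc]
      exact (hg1 _).trans (by gcongr)
  have hgeo : Summable fun n : ℕ => (2⁻¹ : ℝ) ^ n * ‖y‖ :=
    (summable_geometric_of_lt_one (by norm_num) (by norm_num)).mul_right _
  have hr0 : Tendsto r atTop (𝓝 0) := squeeze_zero_norm hr hgeo.tendsto_atTop_zero
  have hs : Summable fun n => g (r n) := by
    refine Summable.of_norm_bounded (hgeo.mul_left |K|) fun n => (hg2 _).trans ?_
    calc K * ‖r n‖ ≤ |K| * ‖r n‖ := by gcongr; exact le_abs_self K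
      _ ≤ _ := by gcongr; exact hr n
  refine ⟨∑' n, g (r n), ?_⟩
  have h1 : Tendsto (fun N => f (∑ n ∈ Finset.range N, g (r n))) atTop (𝓝 (f (∑' n, g (r n)))) :=
    (f.continuous.tendsto _).comp hs.hasSum.tendsto_sum_nat
  have h2 : ∀ N, f (∑ n ∈ Finset.range N, g (r n)) = y - r N := by
    intro N
    induction N with
    | zero => simp [r]
    | succ N ih => rw [Finset.sum_range_succ, map_add, ih, r_succ]; abel
  simp only [h2] at h1
  refine tendsto_nhds_unique h1 ?_
  simpa using hr0.const_sub y

/-- An operator whose transpose is bounded below is surjective. -/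
theorem surjective_of_dual [CompleteSpace E] {f : E →L[ℂ] F} {d : ℝ} (hd : 0 < d)
    (h : ∀ φ : F →L[ℂ] ℂ, d * ‖φ‖ ≤ ‖φ.comp f‖) : Function.Surjective f := by
  refine surjective_of_approx (K := d⁻¹) fun y => ?_
  rcases eq_or_ne y 0 with rfl | hy
  · exact ⟨0, by simp⟩
  have hy0 : 0 < ‖y‖ := norm_pos_iff.2 hy
  set r := d⁻¹ * ‖y‖ with hr
  have hr0 : 0 < r := by positivity
  -- Approximating `y` by images of a ball is enough. If `y` were outside this closed convex set, a
  -- separating `φ` would satisfy `d * ‖φ‖ * r ≤ u < re (φ y) ≤ ‖φ‖ * ‖y‖`, and the outer terms are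
  -- equal by the choice of `r`.
  suffices hmem : y ∈ closure (f '' Metric.closedBall 0 r) by
    obtain ⟨_, ⟨x, hx, rfl⟩, hxy⟩ := Metric.mem_closure_iff.1 hmem (2⁻¹ * ‖y‖) (by positivity)
    exact ⟨x, by rw [← dist_eq_norm]; exact hxy.le, by simpa using hx⟩
  by_contra hmem
  have hconv : Convex ℝ (closure (f '' Metric.closedBall 0 r)) :=
    ((convex_closedBall (0 : E) r).linear_image ((f.restrictScalars ℝ) : E →ₗ[ℝ] F)).closure
  obtain ⟨φ, u, hφ1, hφ2⟩ := RCLike.geometric_hahn_banach_closed_point (𝕜 := ℂ) hconv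
    isClosed_closure hmem
  have hu : 0 < u := by
    have := hφ1 0 (subset_closure ⟨0, by simp [hr0.le], by simp⟩)
    simpa using this
  have hb : ‖φ.comp f‖ ≤ u / r := by
    refine ContinuousLinearMap.opNorm_le_bound _ (by positivity) fun x => ?_
    rcases eq_or_ne x 0 with rfl | hx
    · simp
    have hx0 : 0 < ‖x‖ := norm_pos_iff.2 hx
    -- The phase `θ` makes `φ (f x)` real and nonnegative, so a bound on real parts becomes a bound
    -- on norms.
    obtain ⟨θ, hθ1, hθ2⟩ := RCLike.exists_norm_eq_mul_self (φ (f x))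
    have := hφ1 (f (((r / ‖x‖ : ℝ) : ℂ) • θ • x)) (subset_closure ⟨_, ?_, rfl⟩)
    · have e : φ (f (((r / ‖x‖ : ℝ) : ℂ) • θ • x)) = ((r / ‖x‖ * ‖φ (f x)‖ : ℝ) : ℂ) := by
        rw [map_smul, map_smul, map_smul, map_smul, smul_eq_mul, smul_eq_mul, ← hθ2]
        push_cast
        rfl
      rw [e, RCLike.re_to_complex, Complex.ofReal_re] at this
      rw [ContinuousLinearMap.comp_apply, div_mul_eq_mul_div, le_div_iff₀ hr0]
      rw [div_mul_eq_mul_div, div_lt_iff₀ hx0] at this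
      linarith
    · rw [mem_closedBall_zero_iff, norm_smul, norm_smul, hθ1, one_mul, Complex.norm_real,
        Real.norm_of_nonneg (by positivity), div_mul_cancel₀ _ hx0.ne']
  have h1 : d * ‖φ‖ * r ≤ u := (le_div_iff₀ hr0).1 ((h φ).trans hb)
  have h2 : (φ y).re ≤ ‖φ‖ * ‖y‖ := (Complex.re_le_norm _).trans (φ.le_opNorm y)
  have h3 : d * ‖φ‖ * r = ‖φ‖ * ‖y‖ := by rw [hr]; field_simp
  rw [RCLike.re_to_complex] at hφ2
  linarith

end BoundedBelow

/-! ### Frontier points of the spectrum -/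

section Frontier

variable {X : Type*} [NormedAddCommGroup X] [NormedSpace ℂ X] [CompleteSpace X]

theorem isUnit_of_inverse_near {a b s : X →L[ℂ] X} {M : ℝ} (h1 : b * s = 1) (h2 : s * b = 1)
    (hs : ‖s‖ ≤ M) (hab : ‖a - b‖ * M < 1) : IsUnit a := by
  -- In the zero algebra `‖s‖⁻¹ = 0`, so the strict perturbation bound is not available.
  rcases subsingleton_or_nontrivial (X →L[ℂ] X) with h | h
  · exact isUnit_of_subsingleton a
  · let u : (X →L[ℂ] X)ˣ := ⟨b, s, h1, h2⟩
    have hs0 : 0 < ‖s‖ := norm_pos_iff.2 fun h0 => by simp [h0] at h1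
    refine (u.ofNearby a ?_).isUnit
    change ‖a - b‖ < ‖s‖⁻¹
    rw [← one_div, lt_div_iff₀ hs0]
    exact lt_of_le_of_lt (by gcongr) hab

omit [CompleteSpace X] in
theorem exists_inverse_near_of_mem_frontier {A : X →L[ℂ] X} {μ : ℂ}
    (hμ : μ ∈ frontier (spectrum ℂ A)) {ε : ℝ} (hε : 0 < ε) :
    ∃ b s : X →L[ℂ] X, b * s = 1 ∧ s * b = 1 ∧ ‖algebraMap ℂ (X →L[ℂ] X) μ - A - b‖ ≤ ε := by
  rw [frontier_eq_closure_inter_closure] at hμ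
  obtain ⟨z, hz, hzμ⟩ := Metric.mem_closure_iff.1 hμ.2 ε hε
  obtain ⟨u, hu⟩ := spectrum.notMem_iff.1 hz
  refine ⟨u, u⁻¹.1, u.mul_inv, u.inv_mul, ?_⟩
  rw [hu, sub_sub_sub_cancel_right, ← map_sub]
  refine ContinuousLinearMap.opNorm_le_bound _ hε.le fun x => ?_
  rw [ContinuousLinearMap.algebraMap_apply, norm_smul, ← dist_eq_norm]
  gcongr

/-- Nearby invertible operators inherit almost the same lower bound, so their inverses are uniformly
bounded and the invertible perturbation reaches the limit. -/
theorem isUnit_of_isBoundedBelow_of_mem_frontier {A : X →L[ℂ] X} {μ : ℂ}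
    (hμ : μ ∈ frontier (spectrum ℂ A)) (h : IsBoundedBelow (algebraMap ℂ (X →L[ℂ] X) μ - A)) :
    IsUnit (algebraMap ℂ (X →L[ℂ] X) μ - A) := by
  obtain ⟨c, hc, h⟩ := h
  -- With `ε = c / 3` the operator `b` keeps the lower bound `2 * c / 3`, and `‖a - b‖ * ‖s‖ ≤ 1 /
  -- 2`.
  obtain ⟨b, s, h1, h2, hab⟩ := exists_inverse_near_of_mem_frontier hμ (ε := c / 3) (by positivity)
  set a := algebraMap ℂ (X →L[ℂ] X) μ - A
  have hs : ‖s‖ ≤ (2 * c / 3)⁻¹ := by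
    refine ContinuousLinearMap.opNorm_le_bound _ (by positivity) fun y => ?_
    have e : b (s y) = y := DFunLike.congr_fun h1 y
    have e1 := h (s y)
    have e2 : ‖a (s y)‖ ≤ ‖y‖ + c / 3 * ‖s y‖ := by
      calc ‖a (s y)‖ = ‖y + (a - b) (s y)‖ := by rw [sub_apply a b, e, add_sub_cancel]
        _ ≤ ‖y‖ + ‖(a - b) (s y)‖ := norm_add_le _ _
        _ ≤ _ := by gcongr; exact ContinuousLinearMap.le_of_opNorm_le _ hab _
    rw [inv_mul_eq_div, le_div_iff₀ (by positivity)]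
    linarith
  refine isUnit_of_inverse_near h1 h2 hs ?_
  calc ‖a - b‖ * (2 * c / 3)⁻¹ ≤ c / 3 * (2 * c / 3)⁻¹ := by gcongr
    _ = 1 / 2 := by field_simp
    _ < 1 := by norm_num

theorem isUnit_of_surjective_of_mem_frontier {A : X →L[ℂ] X} {μ : ℂ}
    (hμ : μ ∈ frontier (spectrum ℂ A))
    (h : Function.Surjective (algebraMap ℂ (X →L[ℂ] X) μ - A)) :
    IsUnit (algebraMap ℂ (X →L[ℂ] X) μ - A) := by
  obtain ⟨K, hK, h⟩ := ContinuousLinearMap.exists_preimage_norm_le _ h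
  -- With `ε = (3 * K)⁻¹`, writing `y = a x` with `‖x‖ ≤ K * ‖y‖` gives `‖s‖ ≤ K + ‖s‖ / 3`, hence
  -- `‖s‖ ≤ 3 * K / 2`.
  obtain ⟨b, s, h1, h2, hab⟩ := exists_inverse_near_of_mem_frontier hμ (ε := (3 * K)⁻¹)
    (by positivity)
  set a := algebraMap ℂ (X →L[ℂ] X) μ - A
  have hs0 : ‖s‖ ≤ K + 3⁻¹ * ‖s‖ := by
    refine ContinuousLinearMap.opNorm_le_bound _ (by positivity) fun y => ?_
    obtain ⟨x, rfl, hx⟩ := h y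
    have e : s (b x) = x := DFunLike.congr_fun h2 x
    calc ‖s (a x)‖ = ‖x + s ((a - b) x)‖ := by rw [sub_apply a b, map_sub, e, add_sub_cancel]
      _ ≤ ‖x‖ + ‖s ((a - b) x)‖ := norm_add_le _ _
      _ ≤ ‖x‖ + ‖s‖ * ((3 * K)⁻¹ * ‖x‖) := by
        gcongr
        exact s.le_opNorm_of_le (ContinuousLinearMap.le_of_opNorm_le _ hab _)
      _ ≤ K * ‖a x‖ + ‖s‖ * ((3 * K)⁻¹ * (K * ‖a x‖)) := by gcongr
      _ = _ := by field_simp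
  have hs : ‖s‖ ≤ 3 / 2 * K := by linarith
  refine isUnit_of_inverse_near h1 h2 hs ?_
  calc ‖a - b‖ * (3 / 2 * K) ≤ (3 * K)⁻¹ * (3 / 2 * K) := by gcongr
    _ = 1 / 2 := by field_simp
    _ < 1 := by norm_num

end Frontier

/-! ### Bijectivity forces disjoint spectra -/

section Converse

variable {X Y : Type*} [NormedAddCommGroup X] [NormedSpace ℂ X]
  [NormedAddCommGroup Y] [NormedSpace ℂ Y] {A : X →L[ℂ] X} {B : Y →L[ℂ] Y}

theorem sylvester_apply_apply (A : X →L[ℂ] X) (B : Y →L[ℂ] Y) (μ : ℂ) (Z : Y →L[ℂ] X) (y : Y) :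
    sylvester A B Z y = Z ((algebraMap ℂ (Y →L[ℂ] Y) μ - B) y) -
      (algebraMap ℂ (X →L[ℂ] X) μ - A) (Z y) := by
  simp only [sylvester_apply, sub_apply, ContinuousLinearMap.comp_apply,
    ContinuousLinearMap.algebraMap_apply, map_sub, map_smul]
  abel

/-- On `φ ⊗ x` with `x` almost annihilated by `μ - A`, the Sylvester operator is nearly `(φ ∘ (μ -
B)) ⊗ x`. Its lower bound thus passes to the transpose of `μ - B`; half of `c` absorbs the error. -/
theorem surjective_right_of_sylvester [CompleteSpace Y] (μ : ℂ)
    (hT : IsBoundedBelow (sylvester A B))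
    (hA : ¬IsBoundedBelow (algebraMap ℂ (X →L[ℂ] X) μ - A)) :
    Function.Surjective (algebraMap ℂ (Y →L[ℂ] Y) μ - B) := by
  obtain ⟨c, hc, hT⟩ := hT
  obtain ⟨x, hx⟩ := exists_norm_lt_of_not_isBoundedBelow hA (ε := c / 2) (by positivity)
  have hx0 : 0 < ‖x‖ := norm_pos_iff.2 fun h => by simp [h] at hx
  refine surjective_of_dual (d := c / 2) (by positivity) fun φ => ?_
  have h1 := hT (φ.smulRight x)
  have h2 : sylvester A B (φ.smulRight x) =
      (φ.comp (algebraMap ℂ (Y →L[ℂ] Y) μ - B)).smulRight x -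
      φ.smulRight ((algebraMap ℂ (X →L[ℂ] X) μ - A) x) := by
    ext y
    rw [sylvester_apply_apply A B μ]
    simp only [ContinuousLinearMap.smulRight_apply, map_smul, sub_apply,
      ContinuousLinearMap.comp_apply]
  have h3 := norm_sub_le ((φ.comp (algebraMap ℂ (Y →L[ℂ] Y) μ - B)).smulRight x)
    (φ.smulRight ((algebraMap ℂ (X →L[ℂ] X) μ - A) x))
  rw [← h2] at h3
  simp only [ContinuousLinearMap.norm_smulRight_apply] at h1 h3
  have h4 := mul_le_mul_of_nonneg_left hx.le (norm_nonneg φ)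
  refine le_of_mul_le_mul_right ?_ hx0
  linarith

/-- Solve `T Z = φ ⊗ x` with `φ y = ‖y‖` and evaluate at `y`, which `μ - B` almost annihilates: `-Z
y / ‖y‖` is an approximate preimage of `x`. The constant `(2 * K)⁻¹` makes the error at most `‖x‖ /
2`. -/
theorem surjective_left_of_sylvester [CompleteSpace X] (μ : ℂ) {K : ℝ} (hK : 0 < K)
    (hT : ∀ C, ∃ Z, sylvester A B Z = C ∧ ‖Z‖ ≤ K * ‖C‖)
    (hB : ¬IsBoundedBelow (algebraMap ℂ (Y →L[ℂ] Y) μ - B)) :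
    Function.Surjective (algebraMap ℂ (X →L[ℂ] X) μ - A) := by
  obtain ⟨y, hy⟩ := exists_norm_lt_of_not_isBoundedBelow hB (ε := (2 * K)⁻¹) (by positivity)
  have hy0 : 0 < ‖y‖ := norm_pos_iff.2 fun h => by simp [h] at hy
  obtain ⟨φ, hφ1, hφ2⟩ := exists_dual_vector ℂ y hy0.ne'
  set a := algebraMap ℂ (X →L[ℂ] X) μ - A
  set b := algebraMap ℂ (Y →L[ℂ] Y) μ - B
  refine surjective_of_approx (K := K) fun x => ?_
  obtain ⟨Z, hZ, hZn⟩ := hT (φ.smulRight x)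
  rw [ContinuousLinearMap.norm_smulRight_apply, hφ1, one_mul] at hZn
  have h1 : Z (b y) - a (Z y) = (‖y‖ : ℂ) • x := by
    rw [← sylvester_apply_apply A B μ, hZ, ContinuousLinearMap.smulRight_apply, hφ2]
    rfl
  have hy1 : (‖y‖ : ℂ) ≠ 0 := by exact_mod_cast hy0.ne'
  have hn : ‖(‖y‖ : ℂ)⁻¹‖ = ‖y‖⁻¹ := by rw [norm_inv, Complex.norm_real, norm_norm]
  refine ⟨-((‖y‖ : ℂ)⁻¹ • Z y), ?_, ?_⟩
  · have h2 : x - a (-((‖y‖ : ℂ)⁻¹ • Z y)) = (‖y‖ : ℂ)⁻¹ • Z (b y) := by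
      rw [sub_eq_iff_eq_add.1 h1, map_neg, map_smul, smul_add, smul_smul, inv_mul_cancel₀ hy1,
        one_smul, sub_neg_eq_add]
    rw [h2, norm_smul, hn, inv_mul_le_iff₀ hy0]
    calc ‖Z (b y)‖ ≤ ‖Z‖ * ‖b y‖ := Z.le_opNorm _
      _ ≤ (K * ‖x‖) * ((2 * K)⁻¹ * ‖y‖) := by gcongr
      _ = _ := by field_simp
  · rw [norm_neg, norm_smul, hn, inv_mul_le_iff₀ hy0]
    calc ‖Z y‖ ≤ ‖Z‖ * ‖y‖ := Z.le_opNorm _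
      _ ≤ (K * ‖x‖) * ‖y‖ := by gcongr
      _ = _ := by ring

variable [CompleteSpace X] [CompleteSpace Y]

/-- If the Sylvester operator is bijective, then the spectra are disjoint. -/
theorem spectrum_inter_eq_empty (hT : Function.Bijective (sylvester A B)) :
    spectrum ℂ A ∩ spectrum ℂ B = ∅ := by
  obtain ⟨K, hK, hK'⟩ := ContinuousLinearMap.exists_preimage_norm_le _ hT.2
  have hbb : IsBoundedBelow (sylvester A B) := by
    refine ⟨K⁻¹, by positivity, fun Z => ?_⟩
    obtain ⟨Z', h1, h2⟩ := hK' (sylvester A B Z)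
    rw [hT.1 h1] at h2
    rwa [inv_mul_le_iff₀ hK]
  have hcl : IsClosed (spectrum ℂ A ∩ spectrum ℂ B) :=
    (spectrum.isClosed A).inter (spectrum.isClosed B)
  by_contra hne
  have huniv : spectrum ℂ A ∩ spectrum ℂ B ≠ univ := fun h =>
    noncompact_univ ℂ (h ▸ (spectrum.isCompact A).inter_right (spectrum.isClosed B))
  -- A set that is neither empty nor the whole connected plane has a frontier point.
  obtain ⟨μ, hμ⟩ := nonempty_frontier_iff.2 ⟨nonempty_iff_ne_empty.2 hne, huniv⟩
  obtain ⟨hμA, hμB⟩ := hcl.frontier_subset hμ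
  have nonunitA : ¬IsUnit (algebraMap ℂ (X →L[ℂ] X) μ - A) := hμA
  have nonunitB : ¬IsUnit (algebraMap ℂ (Y →L[ℂ] Y) μ - B) := hμB
  -- At the frontier of one spectrum, that operator is neither bounded below nor onto. The first
  -- fact makes the other operator onto, the second makes it bounded below.
  rcases frontier_inter_subset _ _ hμ with ⟨h, -⟩ | ⟨-, h⟩
  · have hb := surjective_right_of_sylvester μ hbb fun h' =>
      nonunitA (isUnit_of_isBoundedBelow_of_mem_frontier h h')
    have hb' : IsBoundedBelow (algebraMap ℂ (Y →L[ℂ] Y) μ - B) := by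
      by_contra h'
      exact nonunitA (isUnit_of_surjective_of_mem_frontier h
        (surjective_left_of_sylvester μ hK hK' h'))
    exact nonunitB (ContinuousLinearMap.isUnit_iff_bijective.2 ⟨hb'.injective, hb⟩)
  · have ha := surjective_left_of_sylvester μ hK hK' fun h' =>
      nonunitB (isUnit_of_isBoundedBelow_of_mem_frontier h h')
    have ha' : IsBoundedBelow (algebraMap ℂ (X →L[ℂ] X) μ - A) := by
      by_contra h'
      exact nonunitB (isUnit_of_surjective_of_mem_frontier h
        (surjective_right_of_sylvester μ hbb h'))
    exact nonunitA (ContinuousLinearMap.isUnit_iff_bijective.2 ⟨ha'.injective, ha⟩)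

end Converse

/-! ### Contours along the lines of a square grid -/

namespace Grid

/-- The four directions of the grid. -/
def directions : Finset (ℤ × ℤ) := {(1, 0), (0, 1), (-1, 0), (0, -1)}

theorem sum_directions {M : Type*} [AddCommMonoid M] (f : ℤ × ℤ → M) :
    ∑ u ∈ directions, f u = f (1, 0) + (f (0, 1) + (f (-1, 0) + f (0, -1))) := by
  rw [directions, Finset.sum_insert (by decide), Finset.sum_insert (by decide),
    Finset.sum_insert (by decide), Finset.sum_singleton]

theorem mem_directions {u : ℤ × ℤ} :
    u ∈ directions ↔ u = (1, 0) ∨ u = (0, 1) ∨ u = (-1, 0) ∨ u = (0, -1) := by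
  simp [directions]

/-- A pair of integers as a complex number. -/
def toComplex (p : ℤ × ℤ) : ℂ := ⟨p.1, p.2⟩

/-- The initial point of the side in direction `e.2` of the square of half side `h` centred at
`2 h e.1`, traversed counterclockwise. -/
def sideSource (h : ℝ) (e : (ℤ × ℤ) × (ℤ × ℤ)) : ℂ :=
  h * (2 * toComplex e.1 + toComplex e.2 * (1 - Complex.I))

/-- The end point of the side in direction `e.2` of the square of half side `h` centred at
`2 h e.1`, traversed counterclockwise. -/
def sideTarget (h : ℝ) (e : (ℤ × ℤ) × (ℤ × ℤ)) : ℂ :=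
  h * (2 * toComplex e.1 + toComplex e.2 * (1 + Complex.I))

/-- The same side as a side of the adjacent square. -/
def oppositeSide (e : (ℤ × ℤ) × (ℤ × ℤ)) : (ℤ × ℤ) × (ℤ × ℤ) := (e.1 + e.2, -e.2)

theorem sideSource_opposite (h : ℝ) (e : (ℤ × ℤ) × (ℤ × ℤ)) :
    sideSource h (oppositeSide e) = sideTarget h e := by
  apply Complex.ext <;> simp [sideSource, sideTarget, oppositeSide, toComplex] <;> ring_nf <;> simp

theorem sideTarget_opposite (h : ℝ) (e : (ℤ × ℤ) × (ℤ × ℤ)) :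
    sideTarget h (oppositeSide e) = sideSource h e := by
  apply Complex.ext <;> simp [sideSource, sideTarget, oppositeSide, toComplex] <;> ring_nf <;> simp

/-- Since `u (1 + i) = (i u) (1 - i)`, each side ends where the side a quarter turn further begins.
-/
theorem sideTarget_eq_sideSource_rot (h : ℝ) (p u : ℤ × ℤ) :
    sideTarget h (p, u) = sideSource h (p, (-u.2, u.1)) := by
  apply Complex.ext <;> simp [sideSource, sideTarget, toComplex] <;> ring_nf <;> simp

theorem sum_sides_sub {M : Type*} [AddCommGroup M] (h : ℝ) (p : ℤ × ℤ) (f : ℂ → M) :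
    ∑ u ∈ directions, (f (sideTarget h (p, u)) - f (sideSource h (p, u))) = 0 := by
  simp only [sum_directions, sideTarget_eq_sideSource_rot, neg_zero, neg_neg]
  abel

/-- The sides between a square of `S` and a square outside `S`. -/
def boundarySides (S : Finset (ℤ × ℤ)) : Finset ((ℤ × ℤ) × (ℤ × ℤ)) :=
  (S ×ˢ directions).filter fun e => e.1 + e.2 ∉ S

theorem mem_boundarySides {S : Finset (ℤ × ℤ)} {p u : ℤ × ℤ} :
    (p, u) ∈ boundarySides S ↔ p ∈ S ∧ u ∈ directions ∧ p + u ∉ S := by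
  simp [boundarySides, and_assoc]

/-- A side between two squares of `S` is counted from both with opposite signs; the involution
`oppositeSide` cancels these terms. -/
theorem sum_boundarySides {M : Type*} [AddCommGroup M] (S : Finset (ℤ × ℤ))
    (f : (ℤ × ℤ) × (ℤ × ℤ) → M) (hf : ∀ e, f (oppositeSide e) = -f e) :
    ∑ e ∈ boundarySides S, f e = ∑ p ∈ S, ∑ u ∈ directions, f (p, u) := by
  rw [← Finset.sum_product', ← Finset.sum_filter_add_sum_filter_not (S ×ˢ directions)
    fun e => e.1 + e.2 ∉ S, boundarySides, left_eq_add]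
  refine Finset.sum_involution (fun e _ => oppositeSide e) (fun e _ => ?_) (fun e he _ h => ?_)
    (fun e he => ?_) (fun e _ => ?_)
  · rw [hf, add_neg_cancel]
  · have h2 : -e.2 = e.2 := congrArg Prod.snd h
    rw [Finset.mem_filter, Finset.mem_product, mem_directions] at he
    rcases he.1.2 with h' | h' | h' | h' <;> rw [h'] at h2 <;> revert h2 <;> decide
  · simp only [Finset.mem_filter, Finset.mem_product, not_not, mem_directions, oppositeSide,
      add_neg_cancel_right] at he ⊢
    refine ⟨⟨he.2, ?_⟩, he.1.1⟩
    rcases he.1.2 with h' | h' | h' | h' <;> rw [h'] <;> decide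
  · simp [oppositeSide]

/-- As many arcs end as begin at each point, so bijections between the fibres glue to a permutation.
-/
theorem exists_perm_of_sum_eq {n : ℕ} (s t : Fin n → ℂ)
    (h : ∀ v, ∑ i, ((if t i = v then 1 else 0) - if s i = v then 1 else 0 : ℤ) = 0) :
    ∃ e : Equiv.Perm (Fin n), ∀ i, t i = s (e i) := by
  have hc : ∀ v, Nonempty ({i // t i = v} ≃ {i // s i = v}) := by
    intro v
    refine ⟨Fintype.equivOfCardEq ?_⟩
    have := h v
    rw [Finset.sum_sub_distrib, sub_eq_zero, Finset.sum_boole, Finset.sum_boole] at this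
    rw [Fintype.card_subtype, Fintype.card_subtype]
    exact_mod_cast this
  have e := fun v => (hc v).some
  exact ⟨Equiv.ofFiberEquiv e, fun i => (Equiv.ofFiberEquiv_map e i).symm⟩

theorem sum_boundarySides_equivFin {M : Type*} [AddCommMonoid M] (S : Finset (ℤ × ℤ))
    (f : (ℤ × ℤ) × (ℤ × ℤ) → M) :
    ∑ i, f ((boundarySides S).equivFin.symm i) = ∑ e ∈ boundarySides S, f e := by
  rw [Equiv.sum_comp (boundarySides S).equivFin.symm fun e => f e]
  exact Finset.sum_coe_sort (boundarySides S) f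

/-- The boundary of the union of the squares of a finite set `S`, as a contour. -/
def contour (h : ℝ) (S : Finset (ℤ × ℤ)) : Contour where
  n := (boundarySides S).card
  source i := sideSource h ((boundarySides S).equivFin.symm i)
  target i := sideTarget h ((boundarySides S).equivFin.symm i)
  arc i := Path.segment _ _
  contDiffOn_arc i := by
    refine ContDiffOn.congr (f := fun t => AffineMap.lineMap
      (sideSource h ((boundarySides S).equivFin.symm i))
      (sideTarget h ((boundarySides S).equivFin.symm i)) t) ?_ (Path.eqOn_extend_segment _ _)
    simp only [AffineMap.lineMap_apply_module]
    fun_prop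
  closed := by
    refine exists_perm_of_sum_eq
      (fun i => sideSource h ((boundarySides S).equivFin.symm i))
      (fun i => sideTarget h ((boundarySides S).equivFin.symm i)) fun v => ?_
    rw [sum_boundarySides_equivFin S fun e => ((if sideTarget h e = v then 1 else 0) -
      if sideSource h e = v then 1 else 0 : ℤ), sum_boundarySides]
    · exact Finset.sum_eq_zero fun p _ => sum_sides_sub h p fun w => if w = v then 1 else 0
    · intro e
      rw [sideSource_opposite, sideTarget_opposite, neg_sub]

theorem carrier_contour (h : ℝ) (S : Finset (ℤ × ℤ)) :
    (contour h S).carrier = ⋃ e ∈ boundarySides S, segment ℝ (sideSource h e) (sideTarget h e) := by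
  rw [← (boundarySides S).set_biUnion_coe]
  have : (contour h S).carrier = ⋃ i : Fin (boundarySides S).card,
      segment ℝ (sideSource h ((boundarySides S).equivFin.symm i))
        (sideTarget h ((boundarySides S).equivFin.symm i)) :=
    iUnion_congr fun i => Path.range_segment _ _
  rw [this, biUnion_eq_iUnion]
  exact (boundarySides S).equivFin.symm.surjective.iUnion_comp
    fun e : boundarySides S => segment ℝ (sideSource h e) (sideTarget h e)

/-- The integral of `(ζ - z)⁻¹` along a segment. -/
def segmentIntegral (a b z : ℂ) : ℂ :=
  curveIntegral (fun ζ => ContinuousLinearMap.toSpanSingleton ℂ (ζ - z)⁻¹) (Path.segment a b)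

theorem segmentIntegral_symm (a b z : ℂ) : segmentIntegral b a z = -segmentIntegral a b z := by
  rw [segmentIntegral, ← Path.segment_symm, curveIntegral_symm, segmentIntegral]

theorem integral_contour (h : ℝ) (S : Finset (ℤ × ℤ)) (z : ℂ) :
    ((contour h S).integral fun ζ => (ζ - z)⁻¹) =
      ∑ p ∈ S, ∑ u ∈ directions, segmentIntegral (sideSource h (p, u)) (sideTarget h (p, u)) z := by
  rw [← sum_boundarySides S fun e => segmentIntegral (sideSource h e) (sideTarget h e) z,
    ← sum_boundarySides_equivFin S fun e => segmentIntegral (sideSource h e) (sideTarget h e) z]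
  · rfl
  · intro e
    rw [sideSource_opposite, sideTarget_opposite, segmentIntegral_symm]

/-- The factor `m` cancels in the logarithmic derivative; it serves to move the segment off the
branch cut. -/
theorem segmentIntegral_eq_log {a b z : ℂ} (m : ℂ)
    (h : ∀ t ∈ Icc (0 : ℝ) 1, (AffineMap.lineMap a b t - z) * m ∈ Complex.slitPlane) :
    segmentIntegral a b z = Complex.log ((b - z) * m) - Complex.log ((a - z) * m) := by
  rw [segmentIntegral, curveIntegral_segment]
  have hd : ∀ t : ℝ, HasDerivAt (fun t : ℝ => AffineMap.lineMap a b t) (b - a) t := fun t =>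
    AffineMap.hasDerivAt_lineMap
  have hm : ∀ t ∈ Icc (0 : ℝ) 1, (AffineMap.lineMap a b t - z) ≠ 0 ∧ m ≠ 0 := fun t ht =>
    mul_ne_zero_iff.1 (Complex.slitPlane_ne_zero (h t ht))
  have h1 : ∀ t ∈ uIcc (0 : ℝ) 1, HasDerivAt
      (fun t : ℝ => Complex.log ((AffineMap.lineMap a b t - z) * m))
      ((ContinuousLinearMap.toSpanSingleton ℂ (AffineMap.lineMap a b t - z)⁻¹) (b - a)) t := by
    intro t ht
    rw [uIcc_of_le zero_le_one] at ht
    convert! (((hd t).sub_const z).mul_const m).clog_real (h t ht) using 1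
    rw [ContinuousLinearMap.toSpanSingleton_apply, smul_eq_mul, mul_div_mul_right _ _ (hm t ht).2,
      div_eq_mul_inv]
  rw [intervalIntegral.integral_eq_sub_of_hasDerivAt h1]
  · simp
  · refine ContinuousOn.intervalIntegrable ?_
    rw [uIcc_of_le zero_le_one]
    simp only [ContinuousLinearMap.toSpanSingleton_apply, smul_eq_mul]
    refine continuousOn_const.mul (ContinuousOn.inv₀ ?_ fun t ht => (hm t ht).1)
    exact (continuous_iff_continuousAt.2 fun t => (hd t).continuousAt).continuousOn.sub
      continuousOn_const

end Grid

/-! ### Unions of grid squares and their frontiers -/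

namespace Grid

/-- The closed square of half side `h` centred at `2 h p`. -/
def square (h : ℝ) (p : ℤ × ℤ) : Set ℂ :=
  Icc (2 * h * p.1 - h) (2 * h * p.1 + h) ×ℂ Icc (2 * h * p.2 - h) (2 * h * p.2 + h)

/-- The open square of half side `h` centred at `2 h p`. -/
def openSquare (h : ℝ) (p : ℤ × ℤ) : Set ℂ :=
  Ioo (2 * h * p.1 - h) (2 * h * p.1 + h) ×ℂ Ioo (2 * h * p.2 - h) (2 * h * p.2 + h)

variable {h : ℝ} {p q u : ℤ × ℤ} {z : ℂ} {S : Finset (ℤ × ℤ)}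

theorem mem_square : z ∈ square h p ↔
    (2 * h * p.1 - h ≤ z.re ∧ z.re ≤ 2 * h * p.1 + h) ∧
      (2 * h * p.2 - h ≤ z.im ∧ z.im ≤ 2 * h * p.2 + h) := by
  simp [square, Complex.mem_reProdIm]

theorem mem_openSquare : z ∈ openSquare h p ↔
    (2 * h * p.1 - h < z.re ∧ z.re < 2 * h * p.1 + h) ∧
      (2 * h * p.2 - h < z.im ∧ z.im < 2 * h * p.2 + h) := by
  simp [openSquare, Complex.mem_reProdIm]

theorem isOpen_openSquare : IsOpen (openSquare h p) := isOpen_Ioo.reProdIm isOpen_Ioo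

theorem isCompact_square : IsCompact (square h p) := isCompact_Icc.reProdIm isCompact_Icc

theorem openSquare_subset : openSquare h p ⊆ square h p := fun _ hz =>
  ⟨Ioo_subset_Icc_self hz.1, Ioo_subset_Icc_self hz.2⟩

theorem closure_openSquare (hh : 0 < h) : closure (openSquare h p) = square h p := by
  rw [openSquare, Complex.closure_reProdIm, closure_Ioo (by linarith), closure_Ioo (by linarith),
    square]

theorem abs_sub_le_one (hh : 0 < h) {m n : ℤ} {x : ℝ} (h1 : 2 * h * m - h ≤ x)
    (h2 : x ≤ 2 * h * m + h) (h3 : 2 * h * n - h ≤ x) (h4 : x ≤ 2 * h * n + h) :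
    n - m = 0 ∨ n - m = 1 ∨ n - m = -1 := by
  have h5 : (n : ℝ) - m ≤ 1 := by
    refine le_of_mul_le_mul_left ?_ hh
    linarith
  have h6 : (m : ℝ) - n ≤ 1 := by
    refine le_of_mul_le_mul_left ?_ hh
    linarith
  have h7 : n - m ≤ 1 := by exact_mod_cast h5
  have h8 : m - n ≤ 1 := by exact_mod_cast h6
  omega

theorem eq_of_openInterval (hh : 0 < h) {m n : ℤ} {x : ℝ} (h1 : 2 * h * m - h < x)
    (h2 : x < 2 * h * m + h) (h3 : 2 * h * n - h ≤ x) (h4 : x ≤ 2 * h * n + h) : m = n := by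
  have h5 : (n : ℝ) - m < 1 := by
    refine lt_of_mul_lt_mul_left ?_ hh.le
    linarith
  have h6 : (m : ℝ) - n < 1 := by
    refine lt_of_mul_lt_mul_left ?_ hh.le
    linarith
  have h7 : n - m < 1 := by exact_mod_cast h5
  have h8 : m - n < 1 := by exact_mod_cast h6
  omega

theorem eq_of_mem_openSquare (hh : 0 < h) (h1 : z ∈ openSquare h p) (h2 : z ∈ square h q) :
    p = q := by
  rw [mem_openSquare] at h1
  rw [mem_square] at h2
  exact Prod.ext (eq_of_openInterval hh h1.1.1 h1.1.2 h2.1.1 h2.1.2)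
    (eq_of_openInterval hh h1.2.1 h1.2.2 h2.2.1 h2.2.2)

theorem exists_interval (hh : 0 < h) (x : ℝ) :
    ∃ m : ℤ, 2 * h * m - h ≤ x ∧ x ≤ 2 * h * m + h := by
  refine ⟨round (x / (2 * h)), ?_⟩
  have := abs_le.1 (abs_sub_round (x / (2 * h)))
  have e : x = 2 * h * (x / (2 * h)) := by field_simp
  have h1 := mul_le_mul_of_nonneg_left this.1 hh.le
  have h2 := mul_le_mul_of_nonneg_left this.2 hh.le
  constructor <;> linarith

theorem exists_mem_square (hh : 0 < h) (z : ℂ) : ∃ p, z ∈ square h p := by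
  obtain ⟨m, hm⟩ := exists_interval hh z.re
  obtain ⟨n, hn⟩ := exists_interval hh z.im
  exact ⟨(m, n), mem_square.2 ⟨hm, hn⟩⟩

theorem finite_interval (hh : 0 < h) (R : ℝ) :
    {m : ℤ | ∃ x : ℝ, |x| ≤ R ∧ 2 * h * m - h ≤ x ∧ x ≤ 2 * h * m + h}.Finite := by
  refine (finite_Icc (-⌈(R + h) / (2 * h)⌉) ⌈(R + h) / (2 * h)⌉).subset ?_
  rintro m ⟨x, hx, h1, h2⟩
  rw [abs_le] at hx
  have hc := Int.le_ceil ((R + h) / (2 * h))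
  rw [div_le_iff₀ (by positivity)] at hc
  constructor
  · have : (-⌈(R + h) / (2 * h)⌉ : ℝ) ≤ m := by
      refine le_of_mul_le_mul_left ?_ (by positivity : (0 : ℝ) < 2 * h)
      linarith
    exact_mod_cast this
  · have : (m : ℝ) ≤ ⌈(R + h) / (2 * h)⌉ := by
      refine le_of_mul_le_mul_left ?_ (by positivity : (0 : ℝ) < 2 * h)
      linarith
    exact_mod_cast this

theorem finite_squares (hh : 0 < h) {K : Set ℂ} (hK : Bornology.IsBounded K) :
    {p | (square h p ∩ K).Nonempty}.Finite := by
  obtain ⟨R, hR⟩ := hK.exists_norm_le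
  refine ((finite_interval hh R).prod (finite_interval hh R)).subset ?_
  rintro p ⟨z, hz, hzK⟩
  rw [mem_square] at hz
  exact ⟨⟨z.re, (Complex.abs_re_le_norm z).trans (hR z hzK), hz.1⟩,
    ⟨z.im, (Complex.abs_im_le_norm z).trans (hR z hzK), hz.2⟩⟩

/-- The union of the squares of a finite set. -/
def squares (h : ℝ) (S : Finset (ℤ × ℤ)) : Set ℂ := ⋃ p ∈ S, square h p

theorem mem_squares : z ∈ squares h S ↔ ∃ p ∈ S, z ∈ square h p := by simp [squares]

theorem isCompact_squares : IsCompact (squares h S) :=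
  S.isCompact_biUnion fun _ _ => isCompact_square

/-- Only finitely many squares meet a ball about `z`, and those outside `S` form a closed set that
misses `z`. -/
theorem squares_mem_nhds (hh : 0 < h) (hz : ∀ p, z ∈ square h p → p ∈ S) :
    squares h S ∈ 𝓝 z := by
  have hfin := finite_squares hh (Metric.isBounded_ball (x := z) (r := 1))
  have hcl : IsClosed (⋃ p ∈ {p | (square h p ∩ Metric.ball z 1).Nonempty} \ S, square h p) :=
    hfin.sdiff.isClosed_biUnion fun _ _ => isCompact_square.isClosed
  have hz' : z ∉ ⋃ p ∈ {p | (square h p ∩ Metric.ball z 1).Nonempty} \ S, square h p := by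
    simp only [mem_iUnion, not_exists]
    exact fun p hp hzp => hp.2 (hz p hzp)
  filter_upwards [hcl.isOpen_compl.mem_nhds hz', Metric.ball_mem_nhds z one_pos] with w hw hw1
  obtain ⟨p, hp⟩ := exists_mem_square hh w
  by_contra hwS
  refine hw (mem_biUnion (x := p) ⟨⟨w, hp, hw1⟩, fun hpS => hwS (mem_squares.2 ⟨p, hpS, hp⟩)⟩ hp)

theorem mem_side_iff (hh : 0 < h) (hu : u ∈ directions) :
    z ∈ segment ℝ (sideSource h (p, u)) (sideTarget h (p, u)) ↔
      z ∈ square h p ∧ z ∈ square h (p + u) := by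
  rw [segment_eq_image_lineMap, mem_square, mem_square]
  have hl : ∀ t : ℝ, AffineMap.lineMap (sideSource h (p, u)) (sideTarget h (p, u)) t =
      (⟨2 * h * p.1 + h * (u.1 + u.2) - 2 * (h * t) * u.2,
        2 * h * p.2 + h * (u.2 - u.1) + 2 * (h * t) * u.1⟩ : ℂ) := by
    intro t
    rw [AffineMap.lineMap_apply]
    apply Complex.ext <;> simp [sideSource, sideTarget, toComplex] <;> ring
  simp only [mem_image, hl, Complex.ext_iff]
  rw [mem_directions] at hu
  constructor
  · rintro ⟨t, ⟨ht0, ht1⟩, h1, h2⟩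
    have a0 : 0 ≤ h * t := by positivity
    have a1 : h * t ≤ h := mul_le_of_le_one_right hh.le ht1
    rw [← h1, ← h2]
    rcases hu with rfl | rfl | rfl | rfl <;>
      refine ⟨⟨⟨?_, ?_⟩, ?_, ?_⟩, ⟨?_, ?_⟩, ?_, ?_⟩ <;> simp <;> linarith
  · rintro ⟨⟨⟨h1, h2⟩, h3, h4⟩, ⟨h5, h6⟩, h7, h8⟩
    -- The parameter is the coordinate along the side, rescaled from `[-h, h]` to `[0, 1]`.
    refine ⟨1 / 2 + (u.1 * (z.im - 2 * h * p.2) - u.2 * (z.re - 2 * h * p.1)) / (2 * h), ?_⟩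
    have e : h * (1 / 2 + (u.1 * (z.im - 2 * h * p.2) - u.2 * (z.re - 2 * h * p.1)) / (2 * h)) =
        h / 2 + (u.1 * (z.im - 2 * h * p.2) - u.2 * (z.re - 2 * h * p.1)) / 2 := by
      field_simp
    rw [e]
    have e2 : ∀ x : ℝ, 1 / 2 + x / (2 * h) ∈ Icc (0 : ℝ) 1 ↔ -h ≤ x ∧ x ≤ h := by
      intro x
      rw [show 1 / 2 + x / (2 * h) = (h + x) / (2 * h) by field_simp, mem_Icc,
        le_div_iff₀ (by positivity), div_le_iff₀ (by positivity)]
      constructor <;> rintro ⟨_, _⟩ <;> constructor <;> linarith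
    rw [e2]
    rcases hu with rfl | rfl | rfl | rfl <;> simp at h5 h6 h7 h8 ⊢ <;> constructor <;>
      constructor <;> linarith

theorem carrier_subset_squares (hh : 0 < h) : (contour h S).carrier ⊆ squares h S := by
  rw [carrier_contour]
  refine iUnion₂_subset fun e he z hz => ?_
  obtain ⟨h1, h2, -⟩ := mem_boundarySides.1 he
  exact mem_squares.2 ⟨e.1, h1, ((mem_side_iff hh h2).1 hz).1⟩

theorem add_mem_of_notMem_carrier (hh : 0 < h) (hz : z ∉ (contour h S).carrier) (hp : p ∈ S)
    (hzp : z ∈ square h p) (hu : u ∈ directions) (hzu : z ∈ square h (p + u)) : p + u ∈ S := by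
  by_contra hpu
  refine hz ?_
  rw [carrier_contour]
  exact mem_biUnion (x := (p, u)) (mem_boundarySides.2 ⟨hp, hu, hpu⟩)
    ((mem_side_iff hh hu).2 ⟨hzp, hzu⟩)

/-- Squares that meet only at a corner share no side, so membership in `S` is passed on through
`(q.1, p.2)`, which equals or shares a side with each of them. -/
theorem mem_of_notMem_carrier (hh : 0 < h) (hz : z ∉ (contour h S).carrier) (hp : p ∈ S)
    (hzp : z ∈ square h p) (hzq : z ∈ square h q) : q ∈ S := by
  have hp' := mem_square.1 hzp
  have hq' := mem_square.1 hzq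
  have hr : z ∈ square h (q.1, p.2) := mem_square.2 ⟨hq'.1, hp'.2⟩
  have hrS : (q.1, p.2) ∈ S := by
    have e : (q.1, p.2) = p + (q.1 - p.1, 0) := Prod.ext (by simp) (by simp)
    rcases abs_sub_le_one hh hp'.1.1 hp'.1.2 hq'.1.1 hq'.1.2 with h0 | h0 | h0
    · rwa [e, h0, ← Prod.zero_eq_mk, add_zero]
    all_goals
      rw [e] at hr ⊢
      exact add_mem_of_notMem_carrier hh hz hp hzp (by rw [h0]; decide) hr
  have e : q = (q.1, p.2) + (0, q.2 - p.2) := Prod.ext (by simp) (by simp)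
  rcases abs_sub_le_one hh hp'.2.1 hp'.2.2 hq'.2.1 hq'.2.2 with h0 | h0 | h0
  · rwa [e, h0, ← Prod.zero_eq_mk, add_zero]
  all_goals
    rw [e] at hzq ⊢
    exact add_mem_of_notMem_carrier hh hz hrS hr (by rw [h0]; decide) hzq

theorem square_subset_closure (hh : 0 < h) (hp : p ∈ S) :
    square h p ⊆ closure (interior (squares h S)) := by
  rw [← closure_openSquare hh]
  refine closure_mono (interior_maximal ?_ isOpen_openSquare)
  exact openSquare_subset.trans fun z hz => mem_squares.2 ⟨p, hp, hz⟩

theorem closure_interior_squares (hh : 0 < h) :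
    closure (interior (squares h S)) = squares h S := by
  refine (closure_minimal interior_subset isCompact_squares.isClosed).antisymm fun z hz => ?_
  obtain ⟨p, hp, hzp⟩ := mem_squares.1 hz
  exact square_subset_closure hh hp hzp

theorem carrier_contour_eq_frontier (hh : 0 < h) :
    (contour h S).carrier = frontier (interior (squares h S)) := by
  rw [isOpen_interior.frontier_eq, closure_interior_squares hh]
  refine Subset.antisymm (fun z hz => ⟨carrier_subset_squares hh hz, fun hzi => ?_⟩) ?_
  · rw [carrier_contour] at hz
    obtain ⟨e, he, hze⟩ := mem_iUnion₂.1 hz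
    obtain ⟨h1, h2, h3⟩ := mem_boundarySides.1 he
    have hz2 := ((mem_side_iff hh h2).1 hze).2
    rw [← closure_openSquare hh] at hz2
    -- A boundary side also borders a square outside `S`, whose open square would enter the interior
    -- of the union.
    obtain ⟨w, hw1, hw2⟩ := mem_closure_iff.1 hz2 _ isOpen_interior hzi
    obtain ⟨q, hq, hwq⟩ := mem_squares.1 (interior_subset hw1)
    exact h3 (eq_of_mem_openSquare hh hw2 hwq ▸ hq)
  · rintro z ⟨hz, hzi⟩
    by_contra hzc
    obtain ⟨p, hp, hzp⟩ := mem_squares.1 hz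
    exact hzi (mem_interior_iff_mem_nhds.2 (squares_mem_nhds hh fun q hq =>
      mem_of_notMem_carrier hh hzc hp hzp hq))

end Grid

/-! ### Winding numbers of grid contours -/

namespace Grid

variable {h : ℝ} {p q u : ℤ × ℤ} {z : ℂ} {S : Finset (ℤ × ℤ)}

theorem rot_mem_directions (hu : u ∈ directions) : (-u.2, u.1) ∈ directions := by
  rw [mem_directions] at hu
  rcases hu with rfl | rfl | rfl | rfl <;> decide

/-- One branch of the logarithm serves all four sides, and its increments telescope around the
square. -/
theorem sum_segmentIntegral_eq_zero_of_re_pos (m : ℂ)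
    (hm : ∀ u ∈ directions, 0 < ((sideSource h (p, u) - z) * m).re) :
    ∑ u ∈ directions, segmentIntegral (sideSource h (p, u)) (sideTarget h (p, u)) z = 0 := by
  rw [← sum_sides_sub h p fun ζ => Complex.log ((ζ - z) * m)]
  refine Finset.sum_congr rfl fun u hu => segmentIntegral_eq_log m fun t ht => Or.inl ?_
  have ha := hm u hu
  have hb := hm _ (rot_mem_directions hu)
  rw [← sideTarget_eq_sideSource_rot] at hb
  have e : (AffineMap.lineMap (sideSource h (p, u)) (sideTarget h (p, u)) t - z) * m =
      (1 - t) • ((sideSource h (p, u) - z) * m) + t • ((sideTarget h (p, u) - z) * m) := by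
    rw [AffineMap.lineMap_apply_module]
    simp only [Complex.real_smul]
    push_cast
    ring
  rw [e]
  exact convex_halfSpace_re_gt 0 ha hb (sub_nonneg.2 ht.2) ht.1 (sub_add_cancel 1 t)

theorem sum_segmentIntegral_of_notMem (hh : 0 < h) (hz : z ∉ square h p) :
    ∑ u ∈ directions, segmentIntegral (sideSource h (p, u)) (sideTarget h (p, u)) z = 0 := by
  rw [mem_square, not_and_or, not_and_or, not_and_or] at hz
  simp only [not_le] at hz
  -- Each multiplier turns the half-plane on the square's side of `z` into the right half-plane.
  rcases hz with (hz | hz) | (hz | hz)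
  · refine sum_segmentIntegral_eq_zero_of_re_pos 1 fun u hu => ?_
    rw [mem_directions] at hu
    rcases hu with rfl | rfl | rfl | rfl <;> simp [sideSource, toComplex] <;> linarith
  · refine sum_segmentIntegral_eq_zero_of_re_pos (-1) fun u hu => ?_
    rw [mem_directions] at hu
    rcases hu with rfl | rfl | rfl | rfl <;> simp [sideSource, toComplex] <;> linarith
  · refine sum_segmentIntegral_eq_zero_of_re_pos (-Complex.I) fun u hu => ?_
    rw [mem_directions] at hu
    rcases hu with rfl | rfl | rfl | rfl <;> simp [sideSource, toComplex] <;> linarith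
  · refine sum_segmentIntegral_eq_zero_of_re_pos Complex.I fun u hu => ?_
    rw [mem_directions] at hu
    rcases hu with rfl | rfl | rfl | rfl <;> simp [sideSource, toComplex] <;> linarith

theorem im_div_pos_of_mem_openSquare (hh : 0 < h) (hz : z ∈ openSquare h p)
    (hu : u ∈ directions) : 0 < ((sideTarget h (p, u) - z) / (sideSource h (p, u) - z)).im := by
  rw [mem_openSquare] at hz
  obtain ⟨⟨h1, h2⟩, h3, h4⟩ := hz
  have key : 0 < (sideTarget h (p, u) - z).im * (sideSource h (p, u) - z).re -
      (sideTarget h (p, u) - z).re * (sideSource h (p, u) - z).im := by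
    rw [mem_directions] at hu
    rcases hu with rfl | rfl | rfl | rfl <;> simp [sideSource, sideTarget, toComplex]
    · nlinarith [mul_pos hh (sub_pos.2 h2)]
    · nlinarith [mul_pos hh (sub_pos.2 h4)]
    · nlinarith [mul_pos hh (sub_pos.2 h1)]
    · nlinarith [mul_pos hh (sub_pos.2 h3)]
  rw [Complex.div_im, ← sub_div]
  refine div_pos key (Complex.normSq_pos.2 fun h0 => ?_)
  rw [h0] at key
  simp at key

/-- Divided by the source minus `z`, the segment runs from 1 into the upper half-plane and so avoids
the cut. -/
theorem segmentIntegral_of_mem_openSquare (hh : 0 < h) (hz : z ∈ openSquare h p)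
    (hu : u ∈ directions) : segmentIntegral (sideSource h (p, u)) (sideTarget h (p, u)) z =
      Complex.log ((sideTarget h (p, u) - z) / (sideSource h (p, u) - z)) := by
  have him := im_div_pos_of_mem_openSquare hh hz hu
  have ha : sideSource h (p, u) - z ≠ 0 := fun h0 => by simp [h0] at him
  rw [segmentIntegral_eq_log (sideSource h (p, u) - z)⁻¹, mul_inv_cancel₀ ha, Complex.log_one,
    sub_zero, div_eq_mul_inv]
  intro t ht
  have e : (AffineMap.lineMap (sideSource h (p, u)) (sideTarget h (p, u)) t - z) *
      (sideSource h (p, u) - z)⁻¹ =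
      (1 - t) • (1 : ℂ) + t • ((sideTarget h (p, u) - z) / (sideSource h (p, u) - z)) := by
    rw [AffineMap.lineMap_apply_module]
    simp only [Complex.real_smul]
    push_cast
    field_simp
    ring
  rw [e]
  exact Complex.starConvex_one_slitPlane (Or.inr him.ne') (sub_nonneg.2 ht.2) ht.1
    (sub_add_cancel 1 t)

theorem sum_segmentIntegral_of_mem_openSquare (hh : 0 < h) (hz : z ∈ openSquare h p) :
    ∑ u ∈ directions, segmentIntegral (sideSource h (p, u)) (sideTarget h (p, u)) z =
      2 * Real.pi * Complex.I := by
  set w : ℤ × ℤ → ℂ := fun u => (sideTarget h (p, u) - z) / (sideSource h (p, u) - z) with hw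
  have him : ∀ u ∈ directions, 0 < (w u).im := fun u hu => im_div_pos_of_mem_openSquare hh hz hu
  have hne : ∀ u ∈ directions, w u ≠ 0 := fun u hu h0 => by
    have := him u hu
    simp [h0] at this
  have hsrc : ∀ u ∈ directions, sideSource h (p, u) - z ≠ 0 := fun u hu h0 => by
    have := him u hu
    simp [hw, h0] at this
  have hlog : ∀ u ∈ directions, 0 < (Complex.log (w u)).im ∧ (Complex.log (w u)).im < Real.pi := by
    intro u hu
    rw [Complex.log_im]
    refine ⟨(Complex.arg_nonneg_iff.2 (him u hu).le).lt_of_ne' fun h0 => ?_,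
      Complex.arg_lt_pi_iff.2 (Or.inr (him u hu).ne')⟩
    exact (him u hu).ne' (Complex.arg_eq_zero_iff.1 h0).2
  rw [Finset.sum_congr rfl fun u hu => segmentIntegral_of_mem_openSquare hh hz hu]
  change ∑ u ∈ directions, Complex.log (w u) = _
  have d0 : ((1, 0) : ℤ × ℤ) ∈ directions := by decide
  have d1 : ((0, 1) : ℤ × ℤ) ∈ directions := by decide
  have d2 : ((-1, 0) : ℤ × ℤ) ∈ directions := by decide
  have d3 : ((0, -1) : ℤ × ℤ) ∈ directions := by decide
  -- Each side ends where the next begins, so the four quotients multiply to 1.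
  have hexp : Complex.exp (∑ u ∈ directions, Complex.log (w u)) = 1 := by
    rw [sum_directions, Complex.exp_add, Complex.exp_add, Complex.exp_add, Complex.exp_log (hne _ d0),
      Complex.exp_log (hne _ d1), Complex.exp_log (hne _ d2), Complex.exp_log (hne _ d3)]
    have n0 := hsrc _ d0
    have n1 := hsrc _ d1
    have n2 := hsrc _ d2
    have n3 := hsrc _ d3
    simp only [hw, sideTarget_eq_sideSource_rot, neg_zero, neg_neg]
    field_simp
  obtain ⟨n, hn⟩ := Complex.exp_eq_one_iff.1 hexp
  have himn := congrArg Complex.im hn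
  rw [sum_directions] at himn
  simp only [Complex.add_im] at himn
  have hr : ((n : ℂ) * (2 * Real.pi * Complex.I)).im = n * (2 * Real.pi) := by simp
  rw [hr] at himn
  have l0 := hlog _ d0
  have l1 := hlog _ d1
  have l2 := hlog _ d2
  have l3 := hlog _ d3
  -- Four arguments in `(0, π)` sum to `2πn` in `(0, 4π)`, which leaves `n = 1`.
  have n1 : (0 : ℝ) < n := by
    refine pos_of_mul_pos_left (b := 2 * Real.pi) ?_ (by positivity)
    linarith
  have n2 : (n : ℝ) < 2 := by
    refine lt_of_mul_lt_mul_right (a := 2 * Real.pi) ?_ (by positivity)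
    linarith
  have n3 : n = 1 := by
    have : 0 < n := by exact_mod_cast n1
    have : n < 2 := by exact_mod_cast n2
    omega
  rw [hn, n3, Int.cast_one, one_mul]

theorem index_contour_of_mem_openSquare (hh : 0 < h) (hp : p ∈ S) (hz : z ∈ openSquare h p) :
    (contour h S).index z = 1 := by
  rw [Contour.index, integral_contour, Finset.sum_eq_single_of_mem p hp fun q _ hq =>
    sum_segmentIntegral_of_notMem hh fun hzq => hq (eq_of_mem_openSquare hh hz hzq).symm,
    sum_segmentIntegral_of_mem_openSquare hh hz, inv_mul_cancel₀ Complex.two_pi_I_ne_zero]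

theorem isOrientedBoundary_contour (hh : 0 < h) (S : Finset (ℤ × ℤ)) :
    (contour h S).IsOrientedBoundary (interior (squares h S)) where
  isOpen := isOpen_interior
  isBounded := isCompact_squares.isBounded.subset interior_subset
  carrier_eq := carrier_contour_eq_frontier hh
  index_eq_one z hz := by
    have hzc : z ∉ (contour h S).carrier := by
      rw [carrier_contour_eq_frontier hh, isOpen_interior.frontier_eq]
      exact fun h => h.2 hz
    obtain ⟨p, hp, hzp⟩ := mem_squares.1 (interior_subset hz)
    rw [← closure_openSquare hh] at hzp
    -- The point may lie on a side shared by squares of `S`; continuity of the index carries the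
    -- value 1 over from a nearby open square.
    by_contra hne
    obtain ⟨w, hw, hwp⟩ := ((Contour.continuousAt_index hzc).eventually_ne hne).and_frequently
      (mem_closure_iff_frequently.1 hzp) |>.exists
    exact hw (index_contour_of_mem_openSquare hh hp hwp)
  index_eq_zero z hz := by
    rw [closure_interior_squares hh] at hz
    rw [Contour.index, integral_contour, Finset.sum_eq_zero, mul_zero]
    exact fun p hp => sum_segmentIntegral_of_notMem hh fun hzp => hz (mem_squares.2 ⟨p, hp, hzp⟩)

/-- A compact subset of an open set of the plane has an oriented envelope in the open set. -/
theorem exists_isOrientedEnvelope {σ U : Set ℂ} (hσ : IsCompact σ) (hU : IsOpen U) (hσU : σ ⊆ U) :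
    ∃ Γ : Contour, Γ.IsOrientedEnvelope σ U := by
  obtain ⟨ε, hε, hεU⟩ := hσ.exists_cthickening_subset_open hU hσU
  -- Squares of side `ε / 2` have both coordinate differences at most `ε / 2`, hence lie within `ε`
  -- of each of their points.
  have hh : 0 < ε / 4 := by positivity
  have hfin := finite_squares hh hσ.isBounded
  refine ⟨contour (ε / 4) hfin.toFinset, _, isOrientedBoundary_contour hh _, fun z hz => ?_, ?_⟩
  · exact mem_interior_iff_mem_nhds.2
      (squares_mem_nhds hh fun p hp => hfin.mem_toFinset.2 ⟨z, hp, hz⟩)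
  · rw [closure_interior_squares hh]
    refine Subset.trans (fun z hz => ?_) hεU
    obtain ⟨p, hp, hzp⟩ := mem_squares.1 hz
    obtain ⟨w, hwp, hwσ⟩ := hfin.mem_toFinset.1 hp
    refine Metric.mem_cthickening_of_dist_le z w ε σ hwσ ?_
    rw [mem_square] at hzp hwp
    rw [dist_eq_norm]
    refine (Complex.norm_le_abs_re_add_abs_im _).trans ?_
    have h1 : |(z - w).re| ≤ ε / 2 := by
      rw [Complex.sub_re, abs_le]
      constructor <;> linarith
    have h2 : |(z - w).im| ≤ ε / 2 := by
      rw [Complex.sub_im, abs_le]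
      constructor <;> linarith
    linarith

end Grid

/-! ### Existence of admissible contours and the theorem -/

theorem exists_isAdmissible {X Y : Type*} [NormedAddCommGroup X] [NormedSpace ℂ X] [CompleteSpace X]
    [NormedAddCommGroup Y] [NormedSpace ℂ Y] [CompleteSpace Y] {A : X →L[ℂ] X} {B : Y →L[ℂ] Y}
    (h : spectrum ℂ A ∩ spectrum ℂ B = ∅) :
    ∃ U₁ U₂ Γ₁ Γ₂, IsAdmissible A B (fun z w => 1 / (z - w)) U₁ U₂ Γ₁ Γ₂ := by
  obtain ⟨U₁, U₂, hU₁, hU₂, hA, hB, hd⟩ := SeparatedNhds.of_isCompact_isCompact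
    (spectrum.isCompact A) (spectrum.isCompact B) (disjoint_iff_inter_eq_empty.2 h)
  obtain ⟨Γ₁, hΓ₁⟩ := Grid.exists_isOrientedEnvelope (spectrum.isCompact A) hU₁ hA
  obtain ⟨Γ₂, hΓ₂⟩ := Grid.exists_isOrientedEnvelope (spectrum.isCompact B) hU₂ hB
  refine ⟨U₁, U₂, Γ₁, Γ₂, hU₁, hU₂, fun p hp => ?_, hΓ₁, hΓ₂⟩
  refine analyticAt_const.div (analyticAt_fst.sub analyticAt_snd) fun h0 => ?_
  exact hd.le_bot ⟨hp.1, by rw [sub_eq_zero.1 h0]; exact hp.2⟩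

end SylvesterCalculus

end

theorem theoremt {X Y : Type*}
    [NormedAddCommGroup X] [NormedSpace ℂ X] [CompleteSpace X]
    [NormedAddCommGroup Y] [NormedSpace ℂ Y] [CompleteSpace Y]
    (A : X →L[ℂ] X) (B : Y →L[ℂ] Y) :
    ((∀ C : Y →L[ℂ] X, ∃! Z : Y →L[ℂ] X, A.comp Z - Z.comp B = C) ↔
        spectrum ℂ A ∩ spectrum ℂ B = ∅) ∧
      (spectrum ℂ A ∩ spectrum ℂ B = ∅ →
        ∃ Q : (Y →L[ℂ] X) →L[ℂ] (Y →L[ℂ] X),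
          SylvesterCalculus.IsBoxCalculus A B (fun z w => 1 / (z - w)) Q ∧
            ∀ C Z : Y →L[ℂ] X, A.comp Z - Z.comp B = C ↔ Z = Q C) := by
  have key : spectrum ℂ A ∩ spectrum ℂ B = ∅ →
      ∃ Q : (Y →L[ℂ] X) →L[ℂ] (Y →L[ℂ] X),
        SylvesterCalculus.IsBoxCalculus A B (fun z w => 1 / (z - w)) Q ∧
          ∀ C Z : Y →L[ℂ] X, A.comp Z - Z.comp B = C ↔ Z = Q C := by
    intro h
    have hex := SylvesterCalculus.exists_isAdmissible h
    obtain ⟨U₁, U₂, Γ₁, Γ₂, hΓ⟩ := hex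
    obtain ⟨h1, h2⟩ := hΓ.boxIntegral_inverse
    refine ⟨SylvesterCalculus.boxIntegral A B (fun z w => 1 / (z - w)) Γ₁ Γ₂,
      ⟨⟨U₁, U₂, Γ₁, Γ₂, hΓ⟩, fun U₁' U₂' Γ₁' Γ₂' hΓ' => ?_⟩, fun C Z => ⟨fun hZ => ?_, ?_⟩⟩
    · exact left_inv_eq_right_inv h2 hΓ'.boxIntegral_inverse.1
    · rw [← hZ, ← SylvesterCalculus.sylvester_apply]
      exact (DFunLike.congr_fun h2 Z).symm
    · rintro rfl
      exact DFunLike.congr_fun h1 C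
  refine ⟨⟨fun h => SylvesterCalculus.spectrum_inter_eq_empty
    ((Function.bijective_iff_existsUnique _).2 h), fun h C => ?_⟩, key⟩
  obtain ⟨Q, -, hQ⟩ := key h
  exact ⟨Q C, (hQ C _).2 rfl, fun Z hZ => (hQ C Z).1 hZ⟩
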